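/- Let $k$ be a field and let $H$ be a Hopf algebra over $k$ with bijective antipode. Let ${}^H_H\mathcal{YD}$ be the category of finite-dimensional left Yetter–Drinfeld modules over $H$: an object is a finite-dimensional left $H$-module and left $H$-comodule $M$, with coaction $m\mapsto m_{(-1)}\otimes m_{(0)}$, such that $$(hm)_{(-1)}\otimes (hm)_{(0)}=h_{(1)}m_{(-1)}\mathcal S(h_{(3)})\otimes h_{(2)}m_{(0)}\qquad (h\in H,\ m\in M);$$ it is a braided monoidal category under $\otimes_k$, with the diagonal action and coaction and with the braiding $c(m\otimes n)=m_{(-1)}n\otimes m_{(0)}$. Let $R$ be a graded Hopf algebra in ${}^H_H\mathcal{YD}$, that is, a Hopf algebra in this braided category together with a decomposition $R=\bigoplus_{n\ge 0}R(n)$ into Yetter–Drinfeld submodules such that $$R(i)R(j)\subseteq R(i+j),\qquad \Delta(R(n))\subseteq\bigoplus_{i+j=n}R(i)\otimes R(j)\qquad\text{for all } i,j,n\ge 0.$$ Let $N\ge 0$ be such that $R(N)\neq 0$ and $R(i)=0$ for all $i>N$, so that $R=\bigoplus_{i=0}^N R(i)$. Then $$\dim_k R(i)=\dim_k R(N-i)\qquad\text{for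 all } 0\le i\le N.$$ -/

import Mathlib

open scoped TensorProduct

/-- A (left) action and a (left) coaction of `H` on the `k`-vector space `M`. The action is a
representation of the algebra `H`; the laws for the coaction are in `IsYetterDrinfeld`. -/
structure ActionCoaction (k H M : Type*) [Field k] [Ring H] [HopfAlgebra k H]
    [AddCommGroup M] [Module k M] where
  /-- The action: `act h m` is `h m`. -/
  act : H →ₐ[k] Module.End k M
  /-- The coaction `m ↦ m₍₋₁₎ ⊗ m₍₀₎`. -/
  coact : M →ₗ[k] H ⊗[k] M

namespace ActionCoaction

noncomputable section

variable {k H M N P : Type*} [Field k] [Ring H] [HopfAlgebra k H]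
  [AddCommGroup M] [Module k M] [AddCommGroup N] [Module k N] [AddCommGroup P] [Module k P]

/-- The map `a ⊗ c ↦ (x ↦ a x S(c))`. -/
def sandwich (k H : Type*) [Field k] [Ring H] [HopfAlgebra k H] :
    H ⊗[k] H →ₗ[k] Module.End k H :=
  TensorProduct.lift ((LinearMap.mul k (Module.End k H)).compl₁₂ (LinearMap.mul k H)
    ((LinearMap.mul k H).flip ∘ₗ HopfAlgebra.antipode k))

/-- The map `a ⊗ (b ⊗ c) ↦ (x ⊗ m ↦ a x S(c) ⊗ b m)`. -/
def twist (V : ActionCoaction k H M) :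
    H ⊗[k] (H ⊗[k] H) →ₗ[k] Module.End k (H ⊗[k] M) :=
  TensorProduct.homTensorHomMap (.id k) H M H M ∘ₗ
    TensorProduct.map (sandwich k H) V.act.toLinearMap ∘ₗ
    (TensorProduct.assoc k H H H).symm.toLinearMap ∘ₗ
    (TensorProduct.comm k H H).toLinearMap.lTensor H

theorem twist_tmul (V : ActionCoaction k H M) (a b c x : H) (m : M) :
    V.twist (a ⊗ₜ (b ⊗ₜ c)) (x ⊗ₜ m) =
      (a * x * HopfAlgebra.antipode k c) ⊗ₜ[k] V.act b m := by
  simp [twist, sandwich, mul_assoc]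

/-- `M` is a left Yetter-Drinfeld module over `H`: it is a left `H`-module, a left `H`-comodule,
and `(h m)₍₋₁₎ ⊗ (h m)₍₀₎ = h₍₁₎ m₍₋₁₎ S(h₍₃₎) ⊗ h₍₂₎ m₍₀₎`. -/
structure IsYetterDrinfeld (V : ActionCoaction k H M) : Prop where
  coassoc : TensorProduct.assoc k H H M ∘ₗ (Coalgebra.comul (R := k)).rTensor M ∘ₗ V.coact =
    V.coact.lTensor H ∘ₗ V.coact
  counit_coact : (Coalgebra.counit (R := k)).rTensor M ∘ₗ V.coact = TensorProduct.mk k k M 1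
  coact_act : ∀ (h : H) (m : M), V.coact (V.act h m) =
    V.twist ((Coalgebra.comul (R := k)).lTensor H (Coalgebra.comul (R := k) h)) (V.coact m)

/-- The unit object `k`: `h` acts by `ε(h)`, and the coaction is `1 ↦ 1 ⊗ 1`. -/
def unit (k H : Type*) [Field k] [Ring H] [HopfAlgebra k H] : ActionCoaction k H k where
  act := (Algebra.ofId k (Module.End k k)).comp (Bialgebra.counitAlgHom k H)
  coact := TensorProduct.mk k H k 1

/-- The tensor product, with `h (m ⊗ n) = h₍₁₎ m ⊗ h₍₂₎ n` and
`m ⊗ n ↦ m₍₋₁₎ n₍₋₁₎ ⊗ (m₍₀₎ ⊗ n₍₀₎)`. -/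
def tensor (V : ActionCoaction k H M) (W : ActionCoaction k H N) :
    ActionCoaction k H (M ⊗[k] N) where
  act := Module.endTensorEndAlgHom.comp
    ((Algebra.TensorProduct.map V.act W.act).comp (Bialgebra.comulAlgHom k H))
  coact := (LinearMap.mul' k H).rTensor (M ⊗[k] N) ∘ₗ
    (TensorProduct.tensorTensorTensorComm k H M H N).toLinearMap ∘ₗ
    TensorProduct.map V.coact W.coact

/-- `f` is a morphism of Yetter-Drinfeld modules: `H`-linear and `H`-colinear. -/
structure IsHom (V : ActionCoaction k H M) (W : ActionCoaction k H N) (f : M →ₗ[k] N) :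
    Prop where
  map_act : ∀ h : H, f ∘ₗ V.act h = W.act h ∘ₗ f
  map_coact : W.coact ∘ₗ f = f.lTensor H ∘ₗ V.coact

/-- The action as a linear map `H ⊗ M → M`. -/
def actLin (V : ActionCoaction k H M) : H ⊗[k] M →ₗ[k] M :=
  TensorProduct.lift V.act.toLinearMap

/-- The braiding `m ⊗ n ↦ m₍₋₁₎ n ⊗ m₍₀₎`. -/
def braiding (V : ActionCoaction k H M) (W : ActionCoaction k H N) :
    M ⊗[k] N →ₗ[k] N ⊗[k] M :=
  W.actLin.rTensor M ∘ₗ (TensorProduct.rightComm k H M N).toLinearMap ∘ₗ V.coact.rTensor N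

/-- The map `id ⊗ c ⊗ id` on `M ⊗ M ⊗ M ⊗ M`, with `c` the braiding of `M` with itself. -/
def midBraiding (V : ActionCoaction k H M) :
    (M ⊗[k] M) ⊗[k] (M ⊗[k] M) →ₗ[k] (M ⊗[k] M) ⊗[k] (M ⊗[k] M) :=
  (TensorProduct.assoc k M M (M ⊗[k] M)).symm.toLinearMap ∘ₗ
    ((TensorProduct.assoc k M M M).toLinearMap ∘ₗ (V.braiding V).rTensor M ∘ₗ
      (TensorProduct.assoc k M M M).symm.toLinearMap).lTensor M ∘ₗ
    (TensorProduct.assoc k M M (M ⊗[k] M)).toLinearMap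

variable {R : Type*} [Ring R] [Algebra k R] [Coalgebra k R]

/-- The algebra and coalgebra `R` over `k`, with the given action and coaction of `H`, is a Hopf
algebra in the braided category of Yetter-Drinfeld modules over `H`. -/
structure IsHopfAlgebra (V : ActionCoaction k H R) : Prop where
  isYetterDrinfeld : V.IsYetterDrinfeld
  -- the four structure maps are morphisms of Yetter-Drinfeld modules
  isHom_mul : (V.tensor V).IsHom V (LinearMap.mul' k R)
  isHom_unit : (unit k H).IsHom V (Algebra.linearMap k R)
  isHom_comul : V.IsHom (V.tensor V) (Coalgebra.comul (R := k))
  isHom_counit : V.IsHom (unit k H) (Coalgebra.counit (R := k))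
  -- the counit is a morphism of algebras
  counit_one : Coalgebra.counit (R := k) (1 : R) = 1
  counit_mul : ∀ x y : R, Coalgebra.counit (R := k) (x * y) =
    Coalgebra.counit (R := k) x * Coalgebra.counit (R := k) y
  -- the comultiplication is a morphism of algebras to the braided tensor square
  comul_one : Coalgebra.comul (R := k) (1 : R) = 1 ⊗ₜ[k] 1
  comul_mul : Coalgebra.comul (R := k) ∘ₗ LinearMap.mul' k R =
    TensorProduct.map (LinearMap.mul' k R) (LinearMap.mul' k R) ∘ₗ V.midBraiding ∘ₗ
      TensorProduct.map (Coalgebra.comul (R := k)) (Coalgebra.comul (R := k))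
  -- there is an antipode
  exists_antipode : ∃ S : R →ₗ[k] R, V.IsHom V S ∧
    LinearMap.mul' k R ∘ₗ S.rTensor R ∘ₗ Coalgebra.comul (R := k) =
      Algebra.linearMap k R ∘ₗ Coalgebra.counit (R := k) ∧
    LinearMap.mul' k R ∘ₗ S.lTensor R ∘ₗ Coalgebra.comul (R := k) =
      Algebra.linearMap k R ∘ₗ Coalgebra.counit (R := k)

/-- `R` is a graded Hopf algebra in the category of Yetter-Drinfeld modules over `H`, with
homogeneous components `𝒜 0, 𝒜 1, 𝒜 2, …`. -/
structure IsGradedHopfAlgebra (V : ActionCoaction k H R) (𝒜 : ℕ → Submodule k R) : Prop where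
  isHopfAlgebra : V.IsHopfAlgebra
  -- `R` is the direct sum of the Yetter-Drinfeld submodules `𝒜 n`
  isInternal : DirectSum.IsInternal 𝒜
  act_mem : ∀ (n : ℕ) (h : H), ∀ x ∈ 𝒜 n, V.act h x ∈ 𝒜 n
  coact_mem : ∀ n : ℕ, ∀ x ∈ 𝒜 n, V.coact x ∈ LinearMap.range ((𝒜 n).subtype.lTensor H)
  mul_mem : ∀ i j : ℕ, ∀ x ∈ 𝒜 i, ∀ y ∈ 𝒜 j, x * y ∈ 𝒜 (i + j)
  comul_mem : ∀ n : ℕ, ∀ x ∈ 𝒜 n, Coalgebra.comul (R := k) x ∈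
    ⨆ p ∈ Finset.HasAntidiagonal.antidiagonal n, LinearMap.range (TensorProduct.mapIncl (𝒜 p.1) (𝒜 p.2))

end

end ActionCoaction

/-! The dimension symmetry is Poincaré duality, and the pairing behind it comes from an integral on
`R`. The dual space `R*` is made a braided Hopf module over `R`. The coaction on `R*` encodes f ↦ (x
↦ f(x₍₁₎) x₍₂₎), for which `R ⊗ R*` is identified with the endomorphisms of `R` by
finite-dimensionality. An element y acts by transposing `dualAct`, that is x ↦ S(y₍₋₁₎)(S(y₍₀₎) x),
the action on `R` of the antipode of y in the bosonization of `R`. The main computation is the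
compatibility of action and coaction (`dualCoact_dualAlgHom`).

Only part of the fundamental theorem of Hopf modules is needed: a nonzero Hopf module has a nonzero
coinvariant m (`exists_coinvariant_ne_zero`), and then y ↦ y m is injective
(`eq_zero_of_apply_coinvariant`). Both follow from the invertibility of y ⊗ m ↦ y₍₁₎ ⊗ y₍₂₎ m. A
coinvariant of `R*` is an integral, a functional f with f(x₍₁₎) x₍₂₎ = f(x) 1, and injectivity says
that f(`dualAct` y x) = 0 for all x forces y = 0.

Homogeneous components of integrals are integrals, so f may be taken concentrated in one degree d.
As `dualAct` adds degrees, the pairing embeds R(i) in the dual of R(d - i). A nonzero element of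
R(N) cannot be killed and f ≠ 0 needs R(d) ≠ 0, hence d = N. The embeddings for i and for N - i give
the two inequalities between dimensions (`finrank_le`). -/

namespace ActionCoaction

noncomputable section

open Coalgebra

/-! ### Convolution along a coaction -/

section Convolution

variable {k C X A N : Type*} [Field k] [AddCommMonoid C] [Module k C] [AddCommMonoid X] [Module k X]
  [Semiring A] [Algebra k A] [AddCommMonoid N] [Module k N] [Module A N] [IsScalarTower k A N]

/-- The convolution `x ↦ F(x₍₋₁₎) • G(x₍₀₎)` along a map `x ↦ x₍₋₁₎ ⊗ x₍₀₎`. -/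
def conv (δ : X →ₗ[k] C ⊗[k] X) (F : C →ₗ[k] A) (G : X →ₗ[k] N) : X →ₗ[k] N :=
  TensorProduct.lift ((Algebra.lsmul k k N).toLinearMap.compl₁₂ F G) ∘ₗ δ

/-- The workhorse for Sweedler calculations: a termwise identity of the integrands gives an identity
of the convolutions, with no choice of representatives for the coaction. -/
theorem conv_congr (δ : X →ₗ[k] C ⊗[k] X) {N' A' : Type*} [Semiring A'] [Algebra k A']
    [AddCommMonoid N'] [Module k N'] [Module A' N'] [IsScalarTower k A' N']
    (F : C →ₗ[k] A) (G : X →ₗ[k] N) (F' : C →ₗ[k] A') (G' : X →ₗ[k] N') {P : Type*}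
    [AddCommMonoid P] [Module k P] (φ : N →ₗ[k] P) (ψ : N' →ₗ[k] P)
    (h : ∀ c x, φ (F c • G x) = ψ (F' c • G' x)) (x : X) :
    φ (conv δ F G x) = ψ (conv δ F' G' x) := by
  have : φ ∘ₗ TensorProduct.lift ((Algebra.lsmul k k N).toLinearMap.compl₁₂ F G) =
      ψ ∘ₗ TensorProduct.lift ((Algebra.lsmul k k N').toLinearMap.compl₁₂ F' G') := by
    ext c x
    simpa using h c x
  exact congr($this (δ x))

theorem conv_assoc {C : Type*} [AddCommMonoid C] [Module k C] [Coalgebra k C]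
    {δ : X →ₗ[k] C ⊗[k] X}
    (hδ : TensorProduct.assoc k C C X ∘ₗ (comul (R := k)).rTensor X ∘ₗ δ = δ.lTensor C ∘ₗ δ)
    (F F' : C →ₗ[k] A) (G : X →ₗ[k] N) :
    conv δ (conv comul F F') G = conv δ F (conv δ F' G) := by
  set Θ : C ⊗[k] (C ⊗[k] X) →ₗ[k] N :=
    TensorProduct.lift ((Algebra.lsmul k k N).toLinearMap.compl₁₂ F
      (TensorProduct.lift ((Algebra.lsmul k k N).toLinearMap.compl₁₂ F' G))) with hΘ
  have h1 : conv δ F (conv δ F' G) = Θ ∘ₗ (δ.lTensor C ∘ₗ δ) := by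
    have : TensorProduct.lift ((Algebra.lsmul k k N).toLinearMap.compl₁₂ F (conv δ F' G)) =
        Θ ∘ₗ δ.lTensor C := by
      ext c x
      simp [Θ, conv]
    rw [conv, this, LinearMap.comp_assoc]
  rw [h1, ← hδ, conv, ← LinearMap.comp_assoc, ← LinearMap.comp_assoc]
  congr 1
  ext c x
  simp only [TensorProduct.AlgebraTensorModule.curry_apply, TensorProduct.curry_apply,
    LinearMap.coe_restrictScalars, TensorProduct.lift.tmul, LinearMap.comp_apply,
    LinearMap.rTensor_tmul, LinearMap.compl₁₂_apply, conv]
  generalize comul (R := k) c = u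
  induction u with
  | zero => simp
  | add u v hu hv => simp only [map_add, LinearMap.add_apply, TensorProduct.add_tmul, hu, hv]
  | tmul a b => simp [Θ]

theorem conv_counit_left {C : Type*} [AddCommMonoid C] [Module k C] [Coalgebra k C]
    {δ : X →ₗ[k] C ⊗[k] X}
    (hδ : (counit (R := k)).rTensor X ∘ₗ δ = TensorProduct.mk k k X 1) (G : X →ₗ[k] N) :
    conv δ ((counit (R := k) (A := C)).smulRight (1 : A)) G = G := by
  ext x
  have h1 : TensorProduct.lift ((Algebra.lsmul k k N).toLinearMap.compl₁₂
      ((counit (R := k) (A := C)).smulRight (1 : A)) G) =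
      TensorProduct.lift ((LinearMap.lsmul k N).compl₂ G) ∘ₗ
        (counit (R := k) (A := C)).rTensor X := by
    ext c x
    simp
  have h2 := congr(TensorProduct.lift ((LinearMap.lsmul k N).compl₂ G) ($hδ x))
  simpa [conv, h1] using h2

theorem conv_counit_right {C : Type*} [AddCommMonoid C] [Module k C] [Coalgebra k C]
    (F : C →ₗ[k] A) (n : N) (c : C) :
    conv comul F ((counit (R := k) (A := C)).smulRight n) c = F c • n := by
  have h1 : TensorProduct.lift ((Algebra.lsmul k k N).toLinearMap.compl₁₂ F
      ((counit (R := k) (A := C)).smulRight n)) =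
      ((Algebra.lsmul k k N).toLinearMap.flip n ∘ₗ F ∘ₗ (TensorProduct.rid k C).toLinearMap) ∘ₗ
        (counit (R := k) (A := C)).lTensor C := by
    ext c x
    simp [smul_comm (counit (R := k) x)]
  simp [conv, h1]

/-- Convolution is compatible with maps that preserve the coaction. -/
theorem conv_comp_of_colinear {δ : X →ₗ[k] C ⊗[k] X} {Y : Type*} [AddCommMonoid Y] [Module k Y]
    {δ' : Y →ₗ[k] C ⊗[k] Y} {f : Y →ₗ[k] X} (hf : δ ∘ₗ f = f.lTensor C ∘ₗ δ')
    (F : C →ₗ[k] A) (G : X →ₗ[k] N) (y : Y) :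
    conv δ F G (f y) = conv δ' F (G ∘ₗ f) y := by
  have h1 : TensorProduct.lift ((Algebra.lsmul k k N).toLinearMap.compl₁₂ F (G ∘ₗ f)) =
      TensorProduct.lift ((Algebra.lsmul k k N).toLinearMap.compl₁₂ F G) ∘ₗ f.lTensor C := by
    ext c x
    simp
  simp only [conv, h1, LinearMap.comp_apply]
  rw [← LinearMap.comp_apply (f := δ), hf, LinearMap.comp_apply]

theorem conv_mem (δ : X →ₗ[k] C ⊗[k] X) {F : C →ₗ[k] A} {G : X →ₗ[k] A} {B : Subalgebra k A}
    (hF : ∀ c, F c ∈ B) (hG : ∀ x, G x ∈ B) (x : X) : conv δ F G x ∈ B := by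
  simp only [conv, LinearMap.comp_apply]
  generalize δ x = u
  induction u with
  | zero => simp
  | add u v hu hv => simpa using add_mem hu hv
  | tmul a b => simpa using mul_mem (hF a) (hG b)

theorem commute_conv (δ : X →ₗ[k] C ⊗[k] X) {F : C →ₗ[k] A} {G : X →ₗ[k] A} {a : A}
    (hF : ∀ c, Commute a (F c)) (hG : ∀ x, Commute a (G x)) (x : X) :
    Commute a (conv δ F G x) := by
  have := conv_mem δ (B := Subalgebra.centralizer k {a}) (F := F) (G := G)
    (fun c => by simpa [Subalgebra.mem_centralizer_iff] using (hF c).eq)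
    (fun c => by simpa [Subalgebra.mem_centralizer_iff] using (hG c).eq) x
  simpa [Subalgebra.mem_centralizer_iff, commute_iff_eq] using this

theorem conv_antipode_left {C : Type*} [Semiring C] [Algebra k C] [Coalgebra k C] {S : C →ₗ[k] C}
    (hS : LinearMap.mul' k C ∘ₗ S.rTensor C ∘ₗ comul (R := k) =
      Algebra.linearMap k C ∘ₗ counit (R := k)) (f : C →ₐ[k] A) :
    conv comul (f.toLinearMap ∘ₗ S) f.toLinearMap = (counit (R := k)).smulRight (1 : A) := by
  have h1 : TensorProduct.lift ((Algebra.lsmul k k A).toLinearMap.compl₁₂ (f.toLinearMap ∘ₗ S)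
      f.toLinearMap) = f.toLinearMap ∘ₗ LinearMap.mul' k C ∘ₗ S.rTensor C := by
    ext c x
    simp
  rw [conv, h1, LinearMap.comp_assoc, LinearMap.comp_assoc, hS]
  ext c
  simp [Algebra.algebraMap_eq_smul_one]

theorem conv_antipode_right {C : Type*} [Semiring C] [Algebra k C] [Coalgebra k C] {S : C →ₗ[k] C}
    (hS : LinearMap.mul' k C ∘ₗ S.lTensor C ∘ₗ comul (R := k) =
      Algebra.linearMap k C ∘ₗ counit (R := k)) (f : C →ₐ[k] A) :
    conv comul f.toLinearMap (f.toLinearMap ∘ₗ S) = (counit (R := k)).smulRight (1 : A) := by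
  have h1 : TensorProduct.lift ((Algebra.lsmul k k A).toLinearMap.compl₁₂ f.toLinearMap
      (f.toLinearMap ∘ₗ S)) = f.toLinearMap ∘ₗ LinearMap.mul' k C ∘ₗ S.lTensor C := by
    ext c x
    simp
  rw [conv, h1, LinearMap.comp_assoc, LinearMap.comp_assoc, hS]
  ext c
  simp [Algebra.algebraMap_eq_smul_one]

theorem assoc_comp_rTensor_comp_comul (C : Type*) [AddCommMonoid C] [Module k C] [Coalgebra k C] :
    TensorProduct.assoc k C C C ∘ₗ (comul (R := k)).rTensor C ∘ₗ comul (R := k) =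
      (comul (R := k)).lTensor C ∘ₗ comul (R := k) := by
  ext; simp

end Convolution

end

end ActionCoaction

/-! ### Braided actions and the antipode of the bosonization -/

namespace ActionCoaction

noncomputable section

open Coalgebra Module.End

variable {k H R M : Type*} [Field k] [Ring H] [HopfAlgebra k H] [Ring R] [Algebra k R]
  [AddCommGroup M] [Module k M] {V : ActionCoaction k H R}

variable (V M) in
/-- The action of `H` on the left factor of `R ⊗ M`. -/
def actLeft : H →ₐ[k] Module.End k (R ⊗[k] M) := (rTensorAlgHom k R M).comp V.act

variable (k R M) in
/-- The multiplication of `R` on the left factor of `R ⊗ M`. -/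
def mulLeft : R →ₐ[k] Module.End k (R ⊗[k] M) := (rTensorAlgHom k R M).comp (Algebra.lmul k R)

variable (R) in
/-- The action of an algebra on the right factor of `R ⊗ M`. -/
def onRight {B : Type*} [Ring B] [Algebra k B] (α : B →ₐ[k] Module.End k M) :
    B →ₐ[k] Module.End k (R ⊗[k] M) :=
  (lTensorAlgHom k M R).comp α

@[simp] theorem actLeft_tmul (h : H) (r : R) (m : M) :
    V.actLeft M h (r ⊗ₜ m) = V.act h r ⊗ₜ m := rfl

@[simp] theorem mulLeft_tmul (y r : R) (m : M) :
    mulLeft k R M y (r ⊗ₜ m) = (y * r) ⊗ₜ m := rfl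

@[simp] theorem onRight_tmul {B : Type*} [Ring B] [Algebra k B] (α : B →ₐ[k] Module.End k M)
    (y : B) (r : R) (m : M) :
    onRight R α y (r ⊗ₜ m) = r ⊗ₜ[k] α y m := rfl

/-- The map `a ⊗ b ↦ S(a) b`. -/
def antipodeMul (S : R →ₗ[k] R) : R ⊗[k] R →ₗ[k] R := LinearMap.mul' k R ∘ₗ S.rTensor R

@[simp]
theorem antipodeMul_tmul (S : R →ₗ[k] R) (a b : R) : antipodeMul S (a ⊗ₜ[k] b) = S a * b := by
  simp [antipodeMul]

variable (V) in
/-- The map `h ↦ (x ↦ (h z) x)`. -/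
def actMul (z : R) : H →ₗ[k] Module.End k R :=
  (Algebra.lmul k R).toLinearMap ∘ₗ V.act.toLinearMap.flip z

variable (V) in
/-- The map `h ↦ (x ↦ S(h) x)` for the antipode of `H`. -/
def antipodeAct : H →ₗ[k] Module.End k R := V.act.toLinearMap ∘ₗ HopfAlgebra.antipode k

variable (V) in
/-- The action of the antipode of the bosonization of `R` on `R`: the map
`y ↦ (x ↦ S(y₍₋₁₎) (S(y₍₀₎) x))`. -/
def dualAct (S : R →ₗ[k] R) : R →ₗ[k] Module.End k R :=
  conv V.coact V.antipodeAct ((Algebra.lmul k R).toLinearMap ∘ₗ S)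

theorem antipodeAct_mul (g h : H) :
    V.antipodeAct (g * h) = V.antipodeAct h * V.antipodeAct g := by
  simp [antipodeAct, HopfAlgebra.antipode_mul_antidistrib]

/-- The coaction of y ⊗ z starts with y₍₋₁₎ z₍₋₁₎. An antimultiplicative F splits it as F(z₍₋₁₎)
F(y₍₋₁₎), so the convolution over y can be done first, inside that over z. -/
theorem conv_tensor_coact {N A : Type*} [Semiring A] [Algebra k A] [AddCommMonoid N] [Module k N]
    [Module A N] [IsScalarTower k A N] {F : H →ₗ[k] A} (hF : ∀ g h, F (g * h) = F h * F g)
    (G : R ⊗[k] R →ₗ[k] N) {y : R} {Q : R →ₗ[k] N}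
    (hQ : ∀ w, Q w = conv V.coact F (G ∘ₗ (TensorProduct.mk k R R).flip w) y) (z : R) :
    conv (V.tensor V).coact F G (y ⊗ₜ z) = conv V.coact F Q z := by
  simp only [conv, LinearMap.comp_apply, tensor, TensorProduct.map_tmul] at hQ ⊢
  generalize V.coact z = v
  induction v with
  | zero => simp
  | add u v hu hv => simp only [map_add, TensorProduct.tmul_add, hu, hv]
  | tmul c d =>
    simp only [TensorProduct.lift.tmul, LinearMap.compl₁₂_apply, hQ]
    generalize V.coact y = u
    induction u with
    | zero => simp
    | add u v hu hv => simp only [map_add, TensorProduct.add_tmul, hu, hv]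
    | tmul a b => simp [hF]

variable [Coalgebra k R]

/-- The antipode of a Hopf algebra in the category of Yetter-Drinfeld modules. -/
structure IsAntipode (V : ActionCoaction k H R) (S : R →ₗ[k] R) : Prop where
  isHom : V.IsHom V S
  rTensor : LinearMap.mul' k R ∘ₗ S.rTensor R ∘ₗ comul (R := k) =
    Algebra.linearMap k R ∘ₗ counit (R := k)
  lTensor : LinearMap.mul' k R ∘ₗ S.lTensor R ∘ₗ comul (R := k) =
    Algebra.linearMap k R ∘ₗ counit (R := k)

namespace IsHopfAlgebra

theorem coact_one (hV : V.IsHopfAlgebra) : V.coact 1 = 1 ⊗ₜ 1 := by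
  simpa [unit] using congr($(hV.isHom_unit.map_coact) 1)

theorem coact_mul (hV : V.IsHopfAlgebra) (x y : R) : V.coact (x * y) = V.coact x * V.coact y := by
  have h := congr($(hV.isHom_mul.map_coact) (x ⊗ₜ y))
  simp only [LinearMap.comp_apply, LinearMap.mul'_apply, tensor, TensorProduct.map_tmul] at h
  rw [h]
  generalize V.coact x = u
  generalize V.coact y = v
  induction u with
  | zero => simp
  | add u v hu hv => simp only [map_add, add_mul, TensorProduct.add_tmul, hu, hv]
  | tmul a b =>
    induction v with
    | zero => simp
    | add u v hu hv => simp only [map_add, mul_add, TensorProduct.tmul_add, hu, hv]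
    | tmul c d => simp

/-- The coaction as a morphism of algebras. -/
def coactAlgHom (hV : V.IsHopfAlgebra) : R →ₐ[k] H ⊗[k] R :=
  AlgHom.ofLinearMap V.coact hV.coact_one hV.coact_mul

@[simp]
theorem coactAlgHom_apply (hV : V.IsHopfAlgebra) (x : R) : hV.coactAlgHom x = V.coact x := rfl

theorem act_one (hV : V.IsHopfAlgebra) (h : H) : V.act h 1 = counit (R := k) h • 1 := by
  have := congr($(hV.isHom_unit.map_act h) 1)
  simpa [unit, Algebra.algebraMap_eq_smul_one] using this.symm

/-- The action of `R` on `R ⊗ M` by `y (r ⊗ m) = y₍₋₁₎ r ⊗ y₍₀₎ m`. -/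
def braidedAct (hV : V.IsHopfAlgebra) (α : R →ₐ[k] Module.End k M) :
    R →ₐ[k] Module.End k (R ⊗[k] M) :=
  Module.endTensorEndAlgHom.comp ((Algebra.TensorProduct.map V.act α).comp hV.coactAlgHom)

end IsHopfAlgebra

namespace IsHopfAlgebra

theorem braidedAct_eq_conv (hV : V.IsHopfAlgebra) (α : R →ₐ[k] Module.End k M) :
    (hV.braidedAct α).toLinearMap =
      conv V.coact (V.actLeft M).toLinearMap (onRight R α).toLinearMap := by
  ext1 y
  simp only [braidedAct, conv, AlgHom.toLinearMap_apply, AlgHom.comp_apply, coactAlgHom_apply,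
    LinearMap.comp_apply]
  generalize V.coact y = u
  induction u with
  | zero => simp
  | add u v hu hv => simp only [map_add, hu, hv]
  | tmul a b =>
    ext
    simp [Module.endTensorEndAlgHom_apply]

/-- The action `y (r ⊗ m) = y₍₁₎ (y₍₂₎₍₋₁₎ r) ⊗ y₍₂₎₍₀₎ m` of `R` on `R ⊗ M` through the
comultiplication. -/
def comulAct (hV : V.IsHopfAlgebra) (α : R →ₐ[k] Module.End k M) :
    R →ₗ[k] Module.End k (R ⊗[k] M) :=
  conv comul (mulLeft k R M).toLinearMap (hV.braidedAct α).toLinearMap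

theorem braidedAct_lmul_apply (hV : V.IsHopfAlgebra) (a b c : R) :
    hV.braidedAct (Algebra.lmul k R) b (a ⊗ₜ c) =
     (LinearMap.mul' k R).lTensor R (TensorProduct.assoc k R R R (V.braiding V (b ⊗ₜ a) ⊗ₜ c)) := by
  simp only [braidedAct, braiding, AlgHom.comp_apply, coactAlgHom_apply,
    LinearMap.comp_apply, LinearMap.rTensor_tmul]
  generalize V.coact b = u
  induction u with
  | zero => simp
  | add u v hu hv =>
    simp only [map_add, LinearMap.add_apply, TensorProduct.add_tmul, hu, hv]
  | tmul a b => simp [actLin, Module.endTensorEndAlgHom_apply]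

/-- This is the axiom `comul_mul` read as the Hopf module compatibility of `R` with itself. -/
theorem comul_mul_apply (hV : V.IsHopfAlgebra) (x y : R) :
    comul (R := k) (x * y) = hV.comulAct (Algebra.lmul k R) x (comul (R := k) y) := by
  have h := congr($(hV.comul_mul) (x ⊗ₜ y))
  simp only [LinearMap.comp_apply, LinearMap.mul'_apply, TensorProduct.map_tmul] at h
  rw [h, comulAct, conv, LinearMap.comp_apply]
  generalize comul (R := k) x = u
  generalize comul (R := k) y = v
  induction u with
  | zero => simp
  | add u v hu hv => simp only [map_add, LinearMap.add_apply, TensorProduct.add_tmul, hu, hv]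
  | tmul a b =>
    induction v with
    | zero => simp
    | add u v hu hv => simp only [map_add, TensorProduct.tmul_add, hu, hv]
    | tmul c d =>
      simp only [TensorProduct.lift.tmul, LinearMap.compl₁₂_apply, AlgHom.toLinearMap_apply,
        Algebra.lsmul_coe, smul_eq_mul, Module.End.mul_apply, braidedAct_lmul_apply, midBraiding,
        LinearMap.comp_apply, LinearEquiv.coe_coe, TensorProduct.assoc_tmul,
        LinearMap.lTensor_tmul, TensorProduct.assoc_symm_tmul, LinearMap.rTensor_tmul]
      generalize V.braiding V (b ⊗ₜ c) = w
      induction w with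
      | zero => simp
      | add u v hu hv => simp only [map_add, TensorProduct.tmul_add, TensorProduct.add_tmul, hu, hv]
      | tmul e f => simp

variable {S : R →ₗ[k] R}

theorem braidedAct_eq_conv_comulAct (hV : V.IsHopfAlgebra) (hS : V.IsAntipode S)
    (α : R →ₐ[k] Module.End k M) :
    conv comul ((mulLeft k R M).toLinearMap ∘ₗ S) (hV.comulAct α) =
      (hV.braidedAct α).toLinearMap := by
  rw [comulAct, ← conv_assoc (assoc_comp_rTensor_comp_comul R), conv_antipode_left hS.rTensor,
    conv_counit_left rTensor_counit_comp_comul]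

theorem conv_braidedAct_comul_antipode (hV : V.IsHopfAlgebra) (hS : V.IsAntipode S) (x y : R) :
    conv comul (hV.braidedAct (Algebra.lmul k R)).toLinearMap
      (comul (R := k) ∘ₗ LinearMap.mulRight k x ∘ₗ S) y =
    mulLeft k R R (S y) (comul (R := k) x) := by
  rw [← hV.braidedAct_eq_conv_comulAct hS, conv_assoc (assoc_comp_rTensor_comp_comul R)]
  -- Multiplicativity of Δ turns y₍₁₎ Δ(S(y₍₂₎) x) into Δ(y₍₁₎ S(y₍₂₎) x) = ε(y) Δ(x).
  have : conv comul (hV.comulAct (Algebra.lmul k R))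
      (comul (R := k) ∘ₗ LinearMap.mulRight k x ∘ₗ S) =
      (counit (R := k)).smulRight (comul (R := k) x) := by
    ext1 z
    have h := conv_congr comul (hV.comulAct (Algebra.lmul k R))
      (comul (R := k) ∘ₗ LinearMap.mulRight k x ∘ₗ S) LinearMap.id S .id
      (comul (R := k) ∘ₗ LinearMap.mulRight k x) (fun a b => by
        simp [mul_assoc, hV.comul_mul_apply a]) z
    have h2 := congr($(conv_antipode_right hS.lTensor (AlgHom.id k R)) z)
    simp only [AlgHom.toLinearMap_id, LinearMap.id_comp] at h2
    rw [LinearMap.id_apply] at h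
    rw [h, h2]
    simp
  rw [this, conv_counit_right]
  rfl

theorem commute_onRight_comulAct (hV : V.IsHopfAlgebra) (α : R →ₐ[k] Module.End k M)
    {f : Module.End k M} (hf : ∀ x, Commute f (α x)) (x : R) :
    Commute (f.lTensor R) (hV.comulAct α x) := by
  refine commute_conv comul (fun c => ?_) (fun c => ?_) x
  · ext a b
    simp
  · rw [hV.braidedAct_eq_conv]
    refine commute_conv V.coact (fun c => ?_) (fun c => ?_) c
    · ext a b
      simp
    · ext a b
      simpa using congr(a ⊗ₜ[k] $(hf c) b)

theorem antipodeMul_comulAct (hV : V.IsHopfAlgebra) (hS : V.IsAntipode S) (x : R)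
    (u : R ⊗[k] R) :
    antipodeMul S (hV.comulAct (Algebra.lmul k R) x u) =
      counit (R := k) x • antipodeMul S u := by
  set T := hV.comulAct (Algebra.lmul k R) x with hT
  -- Right multiplication on the second factor commutes with everything in sight, which reduces the
  -- claim to tensors y ⊗ 1, that is to the map `f` below.
  have hcomm (y w : R) : antipodeMul S (T (y ⊗ₜ w)) = antipodeMul S (T (y ⊗ₜ 1)) * w := by
    have h1 : Commute ((LinearMap.mulRight k w).lTensor R) T :=
      hV.commute_onRight_comulAct _ (fun z => by ext; simp [mul_assoc]) x
    have h2 : antipodeMul S ∘ₗ (LinearMap.mulRight k w).lTensor R =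
        LinearMap.mulRight k w ∘ₗ antipodeMul S := by
      ext; simp [mul_assoc]
    have h3 := congr($h1.eq (y ⊗ₜ 1))
    simp only [Module.End.mul_apply, LinearMap.lTensor_tmul, LinearMap.mulRight_apply,
      one_mul] at h3
    rw [← h3]
    exact congr($h2 (T (y ⊗ₜ 1)))
  set f : R →ₗ[k] R := antipodeMul S ∘ₗ T ∘ₗ (TensorProduct.mk k R R).flip 1 with hf
  -- On Δ(y) the operator `T` gives Δ(x y), which `antipodeMul S` sends to ε(x) ε(y). Cancelling the
  -- identity by convolving with `S` then determines `f`.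
  have h1 : conv comul f (.id : R →ₗ[k] R) =
      (counit (R := k)).smulRight (counit (R := k) x • (1 : R)) := by
    have h2 : TensorProduct.lift ((Algebra.lsmul k k R).toLinearMap.compl₁₂ f .id) =
        antipodeMul S ∘ₗ T := by
      ext y w
      simp [f, hcomm y w]
    have h3 (z : R) : antipodeMul S (comul (R := k) z) = counit (R := k) z • (1 : R) := by
      rw [← Algebra.algebraMap_eq_smul_one]
      exact congr($hS.rTensor z)
    ext y
    simp [conv, h2, hT, ← hV.comul_mul_apply, h3, hV.counit_mul, smul_smul, mul_comm]
  have h2 : f = counit (R := k) x • S := by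
    have h3 : conv comul f (conv comul (.id : R →ₗ[k] R) S) = conv comul (conv comul f .id) S :=
      (conv_assoc (assoc_comp_rTensor_comp_comul R) _ _ _).symm
    have h4 := conv_antipode_right hS.lTensor (AlgHom.id k R)
    simp only [AlgHom.toLinearMap_id, LinearMap.id_comp] at h4
    rw [h1, h4] at h3
    ext y
    have h5 := congr($h3 y)
    rw [conv_counit_right, smul_eq_mul, mul_one] at h5
    rw [h5]
    have h6 := conv_congr comul ((counit (R := k)).smulRight (counit (R := k) x • (1 : R))) S
      ((counit (R := k)).smulRight (1 : R)) S .id (counit (R := k) x • .id)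
      (fun a b => by simp [smul_smul, mul_comm]) y
    rw [conv_counit_left rTensor_counit_comp_comul] at h6
    simpa using h6
  induction u with
  | zero => simp
  | add u v hu hv => simp only [map_add, smul_add, hu, hv]
  | tmul a b =>
    rw [hcomm]
    have := congr($h2 a)
    simp only [f, LinearMap.comp_apply, LinearMap.flip_apply, TensorProduct.mk_apply] at this
    simp [this]

/-- Left multiplication by x is the convolution of `comulAct` with the braided action of the
antipode, and `antipodeMul S` sees the first of these only through the counit. -/
theorem antipodeMul_mulLeft (hV : V.IsHopfAlgebra) (hS : V.IsAntipode S) (x : R)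
    (u : R ⊗[k] R) :
    antipodeMul S (mulLeft k R R x u) =
      antipodeMul S (hV.braidedAct (Algebra.lmul k R) (S x) u) := by
  have h1 : conv comul (hV.comulAct (Algebra.lmul k R))
      ((hV.braidedAct (Algebra.lmul k R)).toLinearMap ∘ₗ S) = (mulLeft k R R).toLinearMap := by
    rw [comulAct, conv_assoc (assoc_comp_rTensor_comp_comul R), conv_antipode_right hS.lTensor]
    ext1 y
    rw [conv_counit_right, smul_eq_mul, mul_one]
  have h2 := conv_congr comul (hV.comulAct (Algebra.lmul k R))
      ((hV.braidedAct (Algebra.lmul k R)).toLinearMap ∘ₗ S)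
      ((counit (R := k)).smulRight (1 : Module.End k (R ⊗[k] R)))
      ((hV.braidedAct (Algebra.lmul k R)).toLinearMap ∘ₗ S)
      (antipodeMul S ∘ₗ LinearMap.applyₗ u) (antipodeMul S ∘ₗ LinearMap.applyₗ u)
      (fun a b => by simp [hV.antipodeMul_comulAct hS]) x
  rw [h1, conv_counit_left rTensor_counit_comp_comul] at h2
  exact h2

theorem antipode_act (hS : V.IsAntipode S) (h : H) (x : R) : S (V.act h x) = V.act h (S x) :=
  congr($(hS.isHom.map_act h) x)

/-- Braided antimultiplicativity of the antipode, S(y z) = (y₍₋₁₎ S(z)) S(y₍₀₎), read off from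
`antipodeMul_mulLeft` on z ⊗ x and the colinearity of `S`. -/
theorem lmul_antipode_mul (hV : V.IsHopfAlgebra) (hS : V.IsAntipode S) (y z : R) :
    Algebra.lmul k R (S (y * z)) =
      conv V.coact (V.actMul (S z)) ((Algebra.lmul k R).toLinearMap ∘ₗ S) y := by
  ext1 x
  have h1 := hV.antipodeMul_mulLeft hS y (z ⊗ₜ x)
  have h2 : (hV.braidedAct (Algebra.lmul k R)) (S y) =
      conv V.coact (V.actLeft R).toLinearMap
        ((onRight R (Algebra.lmul k R)).toLinearMap ∘ₗ S) y := by
    rw [← conv_comp_of_colinear hS.isHom.map_coact, ← hV.braidedAct_eq_conv]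
    rfl
  rw [h2] at h1
  have h3 := conv_congr V.coact (V.actLeft R).toLinearMap
    ((onRight R (Algebra.lmul k R)).toLinearMap ∘ₗ S)
    (V.actMul (S z)) ((Algebra.lmul k R).toLinearMap ∘ₗ S)
    (antipodeMul S ∘ₗ LinearMap.applyₗ (z ⊗ₜ x)) (LinearMap.applyₗ x)
    (fun a b => by simp [actMul, antipode_act hS]) y
  simp only [LinearMap.comp_apply, LinearMap.applyₗ_apply_apply] at h3
  rw [← h3, ← h1]
  simp

theorem act_mul_eq_conv (hV : V.IsHopfAlgebra) (h : H) (z : R) :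
    V.act h * Algebra.lmul k R z = conv comul (V.actMul z) V.act.toLinearMap h := by
  ext x
  have h1 := congr($(hV.isHom_mul.map_act h) (z ⊗ₜ x))
  simp only [LinearMap.comp_apply, LinearMap.mul'_apply, tensor, AlgHom.comp_apply,
    Bialgebra.comulAlgHom_apply] at h1
  simp only [conv, Module.End.mul_apply, LinearMap.comp_apply]
  rw [Algebra.coe_lmul_eq_mul, LinearMap.mul_apply', ← h1]
  generalize comul (R := k) h = u
  induction u with
  | zero => simp
  | add u v hu hv => simp only [map_add, LinearMap.add_apply, hu, hv]
  | tmul a b => simp [actMul, Module.endTensorEndAlgHom_apply]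

/-- As an operator, h z equals h₍₁₎ ∘ z ∘ S(h₍₂₎). Hence S(h₍₁₎) in front cancels and leaves z ∘
S(h). -/
theorem conv_antipodeAct_actMul (hV : V.IsHopfAlgebra) (z : R) :
    conv comul V.antipodeAct (V.actMul z) =
      LinearMap.mulLeft k (Algebra.lmul k R z) ∘ₗ V.antipodeAct := by
  have e1 := conv_antipode_left HopfAlgebra.mul_antipode_rTensor_comul V.act
  have e2 := conv_antipode_right HopfAlgebra.mul_antipode_lTensor_comul V.act
  have h1 : V.actMul z = conv comul V.act.toLinearMap
      (LinearMap.mulLeft k (Algebra.lmul k R z) ∘ₗ V.antipodeAct) := by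
    have h2 : conv comul (conv comul (V.actMul z) V.act.toLinearMap) V.antipodeAct =
        V.actMul z := by
      rw [conv_assoc (assoc_comp_rTensor_comp_comul H), antipodeAct, e2]
      ext1 h
      rw [conv_counit_right, smul_eq_mul, mul_one]
    rw [← h2]
    ext1 h
    refine conv_congr comul _ _ _ _ .id .id (fun a b => ?_) h
    simp [← hV.act_mul_eq_conv, mul_assoc]
  rw [h1, ← conv_assoc (assoc_comp_rTensor_comp_comul H), antipodeAct, e1,
    conv_counit_left rTensor_counit_comp_comul]

theorem conv_antipodeAct_lmul_antipode_mul (hV : V.IsHopfAlgebra) (hS : V.IsAntipode S)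
    (y z : R) :
    conv V.coact V.antipodeAct ((Algebra.lmul k R).toLinearMap ∘ₗ S ∘ₗ LinearMap.mulRight k z) y =
      Algebra.lmul k R (S z) * V.dualAct S y := by
  have h1 : (Algebra.lmul k R).toLinearMap ∘ₗ S ∘ₗ LinearMap.mulRight k z =
      conv V.coact (V.actMul (S z)) ((Algebra.lmul k R).toLinearMap ∘ₗ S) := by
    ext1 x
    exact hV.lmul_antipode_mul hS x z
  rw [h1, ← conv_assoc hV.isYetterDrinfeld.coassoc, hV.conv_antipodeAct_actMul]
  exact conv_congr V.coact _ _ _ _ .id (LinearMap.mulLeft k (Algebra.lmul k R (S z)))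
    (fun a b => by simp [mul_assoc]) y

/-- The twist by S(y₍₋₁₎) absorbs the braiding in S(y z), so `dualAct` is honestly
antimultiplicative and its transpose is an action on the dual. -/
theorem dualAct_mul (hV : V.IsHopfAlgebra) (hS : V.IsAntipode S) (y z : R) :
    V.dualAct S (y * z) = V.dualAct S z * V.dualAct S y := by
  have h1 : V.dualAct S z * V.dualAct S y = conv V.coact V.antipodeAct
      (LinearMap.mulRight k (V.dualAct S y) ∘ₗ (Algebra.lmul k R).toLinearMap ∘ₗ S) z :=
    conv_congr V.coact V.antipodeAct ((Algebra.lmul k R).toLinearMap ∘ₗ S) _ _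
      (LinearMap.mulRight k (V.dualAct S y)) .id (fun a b => by simp [mul_assoc]) z
  rw [h1, ← conv_tensor_coact antipodeAct_mul
    (((Algebra.lmul k R).toLinearMap ∘ₗ S) ∘ₗ LinearMap.mul' k R) (y := y),
    ← conv_comp_of_colinear hV.isHom_mul.map_coact]
  · simp [dualAct]
  · intro w
    exact (hV.conv_antipodeAct_lmul_antipode_mul hS y w).symm

theorem dualAct_one (hV : V.IsHopfAlgebra) (hS : V.IsAntipode S) : V.dualAct S 1 = 1 := by
  have h1 : S 1 = 1 := by
    have := congr($hS.rTensor 1)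
    simpa [hV.comul_one, hV.counit_one] using this
  ext x
  simp [dualAct, conv, hV.coact_one, h1, antipodeAct]

end IsHopfAlgebra
end
end ActionCoaction

/-! ### Shear maps and the fundamental theorem of Hopf modules -/

namespace ActionCoaction

noncomputable section

open Coalgebra Module.End

section Shear

variable {k R X : Type*} [Field k] [Ring R] [Algebra k R] [Coalgebra k R]
  [AddCommGroup X] [Module k X]

/-- The map `y ⊗ x ↦ y₍₁₎ ⊗ β(y₍₂₎) x`. -/
def shear (β : R →ₗ[k] Module.End k X) : R ⊗[k] X →ₗ[k] R ⊗[k] X :=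
  (TensorProduct.lift β).lTensor R ∘ₗ (TensorProduct.assoc k R R X).toLinearMap ∘ₗ
    (comul (R := k)).rTensor X

theorem shear_counit : shear ((counit (R := k) (A := R)).smulRight (1 : Module.End k X)) = .id := by
  ext y x
  have h1 : (TensorProduct.lift ((counit (R := k) (A := R)).smulRight
      (1 : Module.End k X))).lTensor R ∘ₗ (TensorProduct.assoc k R R X).toLinearMap ∘ₗ
      (TensorProduct.mk k (R ⊗[k] R) X).flip x = (TensorProduct.mk k R X).flip x ∘ₗ
        (TensorProduct.rid k R).toLinearMap ∘ₗ (counit (R := k)).lTensor R := by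
    ext a b
    simp
  simpa [shear] using congr($h1 (comul (R := k) y))

/-- By coassociativity both sides are y₍₁₎ ⊗ β(y₍₂₎) γ(y₍₃₎) x. So a convolution inverse of β yields
an inverse of its shear. -/
theorem shear_conv (β γ : R →ₗ[k] Module.End k X) :
    shear (conv comul β γ) = shear β ∘ₗ shear γ := by
  ext y x
  set Θ : R ⊗[k] (R ⊗[k] R) →ₗ[k] R ⊗[k] X :=
    (TensorProduct.lift (β.compl₂ (γ.flip x))).lTensor R with hΘ
  have h1 : (TensorProduct.lift (conv comul β γ)).lTensor R ∘ₗ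
      (TensorProduct.assoc k R R X).toLinearMap ∘ₗ (TensorProduct.mk k (R ⊗[k] R) X).flip x =
      Θ ∘ₗ (comul (R := k)).lTensor R := by
    ext a b
    simp only [TensorProduct.AlgebraTensorModule.curry_apply, TensorProduct.curry_apply,
      LinearMap.coe_restrictScalars, LinearMap.comp_apply, LinearMap.flip_apply,
      TensorProduct.mk_apply, LinearEquiv.coe_coe, TensorProduct.assoc_tmul,
      LinearMap.lTensor_tmul, TensorProduct.lift.tmul, hΘ, conv]
    congr 1
    generalize comul (R := k) b = u
    induction u with
    | zero => simp
    | add u v hu hv => simp only [map_add, LinearMap.add_apply, hu, hv]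
    | tmul c d => simp
  have h2 : shear β ∘ₗ (TensorProduct.lift γ).lTensor R ∘ₗ
      (TensorProduct.assoc k R R X).toLinearMap ∘ₗ (TensorProduct.mk k (R ⊗[k] R) X).flip x =
      Θ ∘ₗ (TensorProduct.assoc k R R R).toLinearMap ∘ₗ (comul (R := k)).rTensor R := by
    ext a b
    simp only [TensorProduct.AlgebraTensorModule.curry_apply, TensorProduct.curry_apply,
      LinearMap.coe_restrictScalars, LinearMap.comp_apply, LinearMap.flip_apply,
      TensorProduct.mk_apply, LinearEquiv.coe_coe, TensorProduct.assoc_tmul,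
      LinearMap.lTensor_tmul, LinearMap.rTensor_tmul, TensorProduct.lift.tmul, hΘ, shear]
    generalize comul (R := k) a = u
    induction u with
    | zero => simp
    | add u v hu hv => simp only [map_add, TensorProduct.add_tmul, hu, hv]
    | tmul c d => simp
  have h3 := congr($h1 (comul (R := k) y))
  have h4 := congr($h2 (comul (R := k) y))
  have h5 := congr(Θ ($(assoc_comp_rTensor_comp_comul R) y))
  simp only [LinearMap.comp_apply, LinearMap.flip_apply, TensorProduct.mk_apply] at h3 h4 h5
  simp only [TensorProduct.AlgebraTensorModule.curry_apply, TensorProduct.curry_apply,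
      LinearMap.coe_restrictScalars, LinearMap.comp_apply]
  conv_lhs => simp only [shear, LinearMap.comp_apply, LinearMap.rTensor_tmul]
  rw [h3]
  conv_rhs => rw [shear.eq_1 γ]; simp only [LinearMap.comp_apply, LinearMap.rTensor_tmul]
  rw [h4]
  exact h5.symm

theorem shear_mk_one_comul (α : R →ₗ[k] Module.End k X) (y : R) (x : X) :
    (shear α).lTensor R (TensorProduct.assoc k R R X (comul (R := k) y ⊗ₜ x)) =
      TensorProduct.assoc k R R X ((comul (R := k)).rTensor X (shear α (y ⊗ₜ x))) := by
  set Θ : R ⊗[k] (R ⊗[k] R) →ₗ[k] R ⊗[k] (R ⊗[k] X) :=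
    ((α.flip x).lTensor R).lTensor R with hΘ
  have h1 : (shear α).lTensor R ∘ₗ (TensorProduct.assoc k R R X).toLinearMap ∘ₗ
      (TensorProduct.mk k (R ⊗[k] R) X).flip x = Θ ∘ₗ (comul (R := k)).lTensor R := by
    ext a b
    simp only [TensorProduct.AlgebraTensorModule.curry_apply, TensorProduct.curry_apply,
      LinearMap.coe_restrictScalars, LinearMap.comp_apply, LinearMap.flip_apply,
      TensorProduct.mk_apply, LinearEquiv.coe_coe, TensorProduct.assoc_tmul,
      LinearMap.lTensor_tmul, LinearMap.rTensor_tmul, hΘ, shear]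
    congr 1
    generalize comul (R := k) b = u
    induction u with
    | zero => simp
    | add u v hu hv => simp only [map_add, TensorProduct.add_tmul, hu, hv]
    | tmul c d => simp
  have h2 : (TensorProduct.assoc k R R X).toLinearMap ∘ₗ (comul (R := k)).rTensor X ∘ₗ
      (TensorProduct.lift α).lTensor R ∘ₗ (TensorProduct.assoc k R R X).toLinearMap ∘ₗ
      (TensorProduct.mk k (R ⊗[k] R) X).flip x =
      Θ ∘ₗ (TensorProduct.assoc k R R R).toLinearMap ∘ₗ (comul (R := k)).rTensor R := by
    ext a b
    simp only [TensorProduct.AlgebraTensorModule.curry_apply, TensorProduct.curry_apply,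
      LinearMap.coe_restrictScalars, LinearMap.comp_apply, LinearMap.flip_apply,
      TensorProduct.mk_apply, LinearEquiv.coe_coe, TensorProduct.assoc_tmul,
      LinearMap.lTensor_tmul, LinearMap.rTensor_tmul, TensorProduct.lift.tmul, hΘ]
    generalize comul (R := k) a = u
    induction u with
    | zero => simp
    | add u v hu hv => simp only [map_add, TensorProduct.add_tmul, hu, hv]
    | tmul c d => simp
  have h3 := congr($h1 (comul (R := k) y))
  have h4 := congr($h2 (comul (R := k) y))
  have h5 := congr(Θ ($(assoc_comp_rTensor_comp_comul R) y))
  simp only [LinearMap.comp_apply, LinearMap.flip_apply, TensorProduct.mk_apply,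
    LinearEquiv.coe_coe] at h3 h4 h5
  rw [h3, ← h5, ← h4]
  simp [shear]

/-- An element of `R ⊗ X` which is killed by all functionals on `R` is zero. -/
theorem exists_rTensor_ne_zero {k R X : Type*} [Field k] [AddCommGroup R] [Module k R]
    [AddCommGroup X] [Module k X] {w : R ⊗[k] X} (hw : w ≠ 0) :
    ∃ g : R →ₗ[k] k, TensorProduct.lid k X (g.rTensor X w) ≠ 0 := by
  classical
  by_contra! h
  refine hw ((TensorProduct.equivFinsuppOfBasisLeft (N := X)
    (Module.Basis.ofVectorSpace k R)).injective ?_)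
  ext i
  rw [TensorProduct.equivFinsuppOfBasisLeft_apply]
  simpa using h _

end Shear

variable {k H R M : Type*} [Field k] [Ring H] [HopfAlgebra k H] [Ring R] [Algebra k R]
  [AddCommGroup M] [Module k M] {V : ActionCoaction k H R} [Coalgebra k R]
  {S : R →ₗ[k] R}

theorem IsAntipode.shear_bijective (hS : V.IsAntipode S) (α : R →ₐ[k] Module.End k M) :
    Function.Bijective (shear α.toLinearMap) := by
  refine Function.bijective_iff_has_inverse.2 ⟨shear (α.toLinearMap ∘ₗ S), fun w => ?_, fun w => ?_⟩
  · rw [← LinearMap.comp_apply, ← shear_conv, conv_antipode_left hS.rTensor, shear_counit]; rfl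
  · rw [← LinearMap.comp_apply, ← shear_conv, conv_antipode_right hS.lTensor, shear_counit]; rfl

namespace IsHopfAlgebra

theorem shear_comulAct_injective (hV : V.IsHopfAlgebra) (hS : V.IsAntipode S)
    (α : R →ₐ[k] Module.End k M) : Function.Injective (shear (hV.comulAct α)) := by
  rw [comulAct, shear_conv]
  exact (hS.shear_bijective _).injective.comp (hS.shear_bijective _).injective

theorem braidedAct_one_tmul (hV : V.IsHopfAlgebra) (α : R →ₐ[k] Module.End k M) (y : R) (m : M) :
    hV.braidedAct α y (1 ⊗ₜ m) = 1 ⊗ₜ α y m := by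
  have h1 := congr($(hV.braidedAct_eq_conv α) y (1 ⊗ₜ m))
  have h2 := conv_congr V.coact (V.actLeft M).toLinearMap (onRight R α).toLinearMap
    ((counit (R := k)).smulRight (1 : Module.End k M)) α.toLinearMap
    (LinearMap.applyₗ (1 ⊗ₜ m)) (TensorProduct.mk k R M 1 ∘ₗ LinearMap.applyₗ m)
    (fun h r => by simp [hV.act_one, TensorProduct.smul_tmul]) y
  rw [conv_counit_left hV.isYetterDrinfeld.counit_coact] at h2
  exact h1.trans h2

theorem comulAct_one_tmul (hV : V.IsHopfAlgebra) (α : R →ₐ[k] Module.End k M) (y : R) (m : M) :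
    hV.comulAct α y (1 ⊗ₜ m) = shear α.toLinearMap (y ⊗ₜ m) := by
  simp only [comulAct, conv, shear, LinearMap.comp_apply, LinearMap.rTensor_tmul]
  generalize comul (R := k) y = u
  induction u with
  | zero => simp
  | add u v hu hv => simp only [map_add, LinearMap.add_apply, TensorProduct.add_tmul, hu, hv]
  | tmul a b => simp [hV.braidedAct_one_tmul]

/-- In a Hopf module, `y ↦ y m` is injective for every nonzero coinvariant `m`. -/
theorem eq_zero_of_apply_coinvariant (hV : V.IsHopfAlgebra) (hS : V.IsAntipode S)
    {α : R →ₐ[k] Module.End k M} {ρ : M →ₗ[k] R ⊗[k] M}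
    (hρ : ∀ y m, ρ (α y m) = hV.comulAct α y (ρ m)) {m : M} (hm : ρ m = 1 ⊗ₜ m) (hm0 : m ≠ 0)
    {y : R} (hy : α y m = 0) : y = 0 := by
  have h1 : shear α.toLinearMap (y ⊗ₜ m) = 0 := by
    rw [← hV.comulAct_one_tmul, ← hm, ← hρ, hy, map_zero]
  have h2 : y ⊗ₜ[k] m = 0 := (hS.shear_bijective α).injective (by rw [h1, map_zero])
  have h3 (f : M →ₗ[k] k) : f m • y = 0 := by
    simpa using congr(TensorProduct.rid k R (f.lTensor R $h2))
  by_contra hy0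
  exact hm0 ((Module.forall_dual_apply_eq_zero_iff k m).1
    fun f => (smul_eq_zero.1 (h3 f)).resolve_right hy0)

/-- A nonzero Hopf module has a nonzero coinvariant. -/
theorem exists_coinvariant_ne_zero (hV : V.IsHopfAlgebra) (hS : V.IsAntipode S)
    {α : R →ₐ[k] Module.End k M} {ρ : M →ₗ[k] R ⊗[k] M}
    (hρ : ∀ y m, ρ (α y m) = hV.comulAct α y (ρ m))
    (hcoassoc : TensorProduct.assoc k R R M ∘ₗ (comul (R := k)).rTensor M ∘ₗ ρ = ρ.lTensor R ∘ₗ ρ)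
    (hinj : Function.Injective ρ) [Nontrivial M] : ∃ m, m ≠ 0 ∧ ρ m = 1 ⊗ₜ m := by
  obtain ⟨m, hm⟩ := exists_ne (0 : M)
  -- The tensor `w` plays the role of the decomposition of m in `R` tensored with the coinvariants.
  obtain ⟨w, hw⟩ := (hS.shear_bijective α).surjective (ρ m)
  have hw0 : w ≠ 0 := by
    rintro rfl
    exact hm (hinj (by rw [← hw, map_zero, map_zero]))
  have h1 : ρ.lTensor R ∘ₗ shear α.toLinearMap = shear (hV.comulAct α) ∘ₗ ρ.lTensor R := by
    ext y m
    simp only [TensorProduct.AlgebraTensorModule.curry_apply, TensorProduct.curry_apply,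
      LinearMap.coe_restrictScalars, LinearMap.comp_apply, shear, LinearMap.lTensor_tmul,
      LinearMap.rTensor_tmul]
    generalize comul (R := k) y = u
    induction u with
    | zero => simp
    | add u v hu hv => simp only [map_add, TensorProduct.add_tmul, hu, hv]
    | tmul a b => simp [hρ]
  have h2 : shear (hV.comulAct α) ∘ₗ (TensorProduct.mk k R M 1).lTensor R =
      (TensorProduct.assoc k R R M).toLinearMap ∘ₗ (comul (R := k)).rTensor M ∘ₗ
        shear α.toLinearMap := by
    ext y m
    have h3 := shear_mk_one_comul α.toLinearMap y m
    simp only [TensorProduct.AlgebraTensorModule.curry_apply, TensorProduct.curry_apply,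
      LinearMap.coe_restrictScalars, LinearMap.comp_apply, LinearEquiv.coe_coe]
    rw [← h3]
    simp only [shear.eq_1 (hV.comulAct α), LinearMap.comp_apply, LinearMap.lTensor_tmul,
      LinearMap.rTensor_tmul]
    generalize comul (R := k) y = u
    induction u with
    | zero => simp
    | add u v hu hv => simp only [map_add, TensorProduct.add_tmul, hu, hv]
    | tmul a b => simp [hV.comulAct_one_tmul]
  -- The second factor of `w` is coinvariant: the injective shear of `comulAct` sends the two sides
  -- to (id ⊗ ρ) ρ(m) and (Δ ⊗ id) ρ(m).
  have h3 : ρ.lTensor R w = (TensorProduct.mk k R M 1).lTensor R w := by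
    apply hV.shear_comulAct_injective hS α
    have h4 := congr($h1 w)
    have h5 := congr($h2 w)
    have h6 := congr($hcoassoc m)
    simp only [LinearMap.comp_apply, hw] at h4 h5 h6
    rw [← h4, h5]
    exact h6.symm
  -- Slicing `w` by a functional on the first factor gives a nonzero vector, still coinvariant since
  -- slicing commutes with ρ.
  obtain ⟨g, hg⟩ := exists_rTensor_ne_zero hw0
  refine ⟨_, hg, ?_⟩
  have h4 (f : M →ₗ[k] R ⊗[k] M) : f ∘ₗ (TensorProduct.lid k M).toLinearMap ∘ₗ g.rTensor M =
      (TensorProduct.lid k (R ⊗[k] M)).toLinearMap ∘ₗ g.rTensor (R ⊗[k] M) ∘ₗ f.lTensor R := by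
    ext a b
    simp
  have h5 := congr($(h4 ρ) w)
  have h6 := congr($(h4 (TensorProduct.mk k R M 1)) w)
  simp only [LinearMap.comp_apply, h3] at h5 h6
  exact h5.trans h6.symm

end IsHopfAlgebra
end
end ActionCoaction

/-! ### The dual space as a Hopf module, and integrals -/

namespace ActionCoaction

noncomputable section

open Coalgebra Module.End

variable {k H R : Type*} [Field k] [Ring H] [HopfAlgebra k H] [Ring R] [Algebra k R]
  {V : ActionCoaction k H R} {S : R →ₗ[k] R}

theorem tensor_act_eq_conv :
    (V.tensor V).act.toLinearMap = conv comul (V.actLeft R).toLinearMap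
      (onRight R V.act).toLinearMap := by
  ext1 h
  simp only [tensor, conv, AlgHom.toLinearMap_apply, AlgHom.comp_apply, LinearMap.comp_apply,
    Bialgebra.comulAlgHom_apply]
  generalize comul (R := k) h = u
  induction u with
  | zero => simp
  | add u v hu hv => simp only [map_add, hu, hv]
  | tmul a b =>
    ext
    simp [Module.endTensorEndAlgHom_apply]

/-- Since S(h₍₂₎) acts on a tensor product as S(h₍₃₎) ⊗ S(h₍₂₎), the factor h₍₁₎ on the right
cancels. -/
theorem conv_onRight_tensor_act_antipode :
    conv comul (onRight R V.act).toLinearMap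
      ((V.tensor V).act.toLinearMap ∘ₗ HopfAlgebra.antipode k) =
    (V.actLeft R).toLinearMap ∘ₗ HopfAlgebra.antipode k := by
  have e1 := conv_antipode_left HopfAlgebra.mul_antipode_rTensor_comul (V.actLeft R)
  have e2 := conv_antipode_right HopfAlgebra.mul_antipode_lTensor_comul (V.tensor V).act
  have h1 : (onRight R V.act).toLinearMap = conv comul
      ((V.actLeft R).toLinearMap ∘ₗ HopfAlgebra.antipode k) (V.tensor V).act.toLinearMap := by
    rw [tensor_act_eq_conv, ← conv_assoc (assoc_comp_rTensor_comp_comul H), e1,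
      conv_counit_left rTensor_counit_comp_comul]
  rw [h1, conv_assoc (assoc_comp_rTensor_comp_comul H), e2]
  ext1 h
  rw [conv_counit_right, smul_eq_mul, mul_one]

variable [Coalgebra k R]

namespace IsHopfAlgebra

theorem conv_antipode_braidedAct (hV : V.IsHopfAlgebra) :
    conv V.coact ((V.actLeft R).toLinearMap ∘ₗ HopfAlgebra.antipode k)
      (hV.braidedAct (Algebra.lmul k R)).toLinearMap =
    (onRight R (Algebra.lmul k R)).toLinearMap := by
  rw [hV.braidedAct_eq_conv, ← conv_assoc hV.isYetterDrinfeld.coassoc,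
    conv_antipode_left HopfAlgebra.mul_antipode_rTensor_comul,
    conv_counit_left hV.isYetterDrinfeld.counit_coact]

/-- The antipode of `H` on the left factor convolved with a braided convolution. -/
theorem conv_antipode_conv_braidedAct (hV : V.IsHopfAlgebra) (G : R →ₗ[k] R ⊗[k] R)
    (y : R) :
    conv V.coact ((V.actLeft R).toLinearMap ∘ₗ HopfAlgebra.antipode k)
      (conv comul (hV.braidedAct (Algebra.lmul k R)).toLinearMap G) y =
    conv comul (onRight R (Algebra.lmul k R)).toLinearMap
      (conv V.coact ((V.actLeft R).toLinearMap ∘ₗ HopfAlgebra.antipode k) G) y := by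
  set F := (V.actLeft R).toLinearMap ∘ₗ HopfAlgebra.antipode k with hF
  have hanti (g h : H) : F (g * h) = F h * F g := by
    simp [F, HopfAlgebra.antipode_mul_antidistrib]
  set B := TensorProduct.lift ((Algebra.lsmul k k (R ⊗[k] R)).toLinearMap.compl₁₂
    (hV.braidedAct (Algebra.lmul k R)).toLinearMap G) with hB
  -- On y₍₁₎ ⊗ y₍₂₎, the antipode at y₍₁₎ undoes the braiding, and the antipode at y₍₂₎ acts on the
  -- left factor only and so passes the multiplication on the right one.
  have h1 : conv (V.tensor V).coact F B = TensorProduct.lift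
      ((Algebra.lsmul k k (R ⊗[k] R)).toLinearMap.compl₁₂
        (onRight R (Algebra.lmul k R)).toLinearMap (conv V.coact F G)) := by
    ext1
    ext1 a
    ext1 c
    simp only [TensorProduct.AlgebraTensorModule.curry_apply, TensorProduct.curry_apply,
      LinearMap.coe_restrictScalars, TensorProduct.lift.tmul, LinearMap.compl₁₂_apply]
    rw [conv_tensor_coact hanti B (y := a) (Q := onRight R (Algebra.lmul k R) a ∘ₗ G)]
    · refine (conv_congr V.coact F G F _ (onRight R (Algebra.lmul k R) a) .id
        (fun h z => ?_) c).symm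
      have : onRight R (Algebra.lmul k R) a * F h = F h * onRight R (Algebra.lmul k R) a := by
        ext
        simp [F]
      simpa using congr($this (G z))
    · intro w
      have h2 := conv_congr V.coact F (hV.braidedAct (Algebra.lmul k R)).toLinearMap
        F (B ∘ₗ (TensorProduct.mk k R R).flip w) (LinearMap.applyₗ (G w)) .id
        (fun h z => by simp [B]) a
      rw [hF, hV.conv_antipode_braidedAct] at h2
      simpa using h2
  have h2 := conv_comp_of_colinear hV.isHom_comul.map_coact F B y
  rw [h1] at h2
  exact h2.symm

/-- The comultiplication of `S(y₍₋₁₎) (S(y₍₀₎) x)`. -/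
theorem comul_dualAct (hV : V.IsHopfAlgebra) (x y : R) :
    comul (R := k) (V.dualAct S y x) =
      conv V.coact ((V.tensor V).act.toLinearMap ∘ₗ HopfAlgebra.antipode k)
        (comul (R := k) ∘ₗ LinearMap.mulRight k x ∘ₗ S) y :=
  conv_congr V.coact V.antipodeAct ((Algebra.lmul k R).toLinearMap ∘ₗ S) _ _
    (comul (R := k) ∘ₗ LinearMap.applyₗ x) .id (fun h z => by
      simpa [antipodeAct] using
        congr($(hV.isHom_comul.map_act (HopfAlgebra.antipode k h)) (S z * x))) y

/-- The Hopf module compatibility of the dual before dualizing; applying f to the left factors gives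
`dualCoact_dualAlgHom`. -/
theorem rTensor_dualAct_comul (hV : V.IsHopfAlgebra) (hS : V.IsAntipode S) (x y : R) :
    (V.dualAct S y).rTensor R (comul (R := k) x) =
      conv comul (onRight R (Algebra.lmul k R)).toLinearMap
        (conv V.coact (onRight R V.act).toLinearMap
          (comul (R := k) ∘ₗ (V.dualAct S).flip x)) y := by
  set G := comul (R := k) ∘ₗ LinearMap.mulRight k x ∘ₗ S with hG
  have h1 : comul (R := k) ∘ₗ (V.dualAct S).flip x =
      conv V.coact ((V.tensor V).act.toLinearMap ∘ₗ HopfAlgebra.antipode k) G := by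
    ext1 z
    exact hV.comul_dualAct x z
  rw [h1, ← conv_assoc hV.isYetterDrinfeld.coassoc, conv_onRight_tensor_act_antipode,
    ← hV.conv_antipode_conv_braidedAct]
  refine conv_congr V.coact V.antipodeAct ((Algebra.lmul k R).toLinearMap ∘ₗ S) _ _
    (LinearMap.applyₗ (comul (R := k) x) ∘ₗ LinearMap.rTensorHom R) .id (fun h z => ?_) y
  rw [LinearMap.id_apply, hG, hV.conv_braidedAct_comul_antipode hS]
  simp [antipodeAct, LinearMap.rTensor_mul]
  rfl

/-- The action of `R` on its dual space. -/
def dualAlgHom (hV : V.IsHopfAlgebra) (hS : V.IsAntipode S) :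
    R →ₐ[k] Module.End k (Module.Dual k R) :=
  AlgHom.ofLinearMap (Module.Dual.transpose (R := k) ∘ₗ V.dualAct S)
    (by ext; simp [hV.dualAct_one hS, Module.Dual.transpose_apply])
    (fun y z => by ext; simp [hV.dualAct_mul hS, Module.Dual.transpose_apply])

theorem dualAlgHom_apply (hV : V.IsHopfAlgebra) (hS : V.IsAntipode S) (y x : R)
    (f : Module.Dual k R) : hV.dualAlgHom hS y f x = f (V.dualAct S y x) := rfl

end IsHopfAlgebra

section EvalDual

variable {k E W : Type*} [Field k] [AddCommGroup E] [Module k E] [AddCommGroup W] [Module k W]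

variable (k E W) in
/-- Evaluation of the second factor of `W ⊗ E*` at elements of `E`. -/
def evalDual : W ⊗[k] Module.Dual k E →ₗ[k] E →ₗ[k] W :=
  dualTensorHom k E W ∘ₗ (TensorProduct.comm k W (Module.Dual k E)).toLinearMap

@[simp]
theorem evalDual_tmul (w : W) (f : Module.Dual k E) (x : E) :
    evalDual k E W (w ⊗ₜ f) x = f x • w := by
  simp [evalDual]

theorem evalDual_injective [FiniteDimensional k E] : Function.Injective (evalDual k E W) := by
  have : Function.Injective (dualTensorHom k E W) := by
    convert! (dualTensorHomEquiv k E W).injective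
  exact this.comp (TensorProduct.comm k W (Module.Dual k E)).injective

end EvalDual

section DualCoaction

/-- The map `f ↦ (x ↦ f(x₍₁₎) x₍₂₎)`. -/
def leftContract (f : Module.Dual k R) : R →ₗ[k] R :=
  (TensorProduct.lid k R).toLinearMap ∘ₗ f.rTensor R ∘ₗ comul

variable (k R) in
/-- The coaction of `R` on its dual space that corresponds to `f ↦ (x ↦ f(x₍₁₎) x₍₂₎)`. -/
def dualCoact [FiniteDimensional k R] : Module.Dual k R →ₗ[k] R ⊗[k] Module.Dual k R :=
  (TensorProduct.comm k (Module.Dual k R) R).toLinearMap ∘ₗ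
    (dualTensorHomEquiv k R R).symm.toLinearMap ∘ₗ
    { toFun := leftContract
      map_add' f g := by ext; simp [leftContract, LinearMap.rTensor_add]
      map_smul' c f := by ext; simp [leftContract, LinearMap.rTensor_smul] }

variable [FiniteDimensional k R]

@[simp]
theorem evalDual_dualCoact (f : Module.Dual k R) :
    evalDual k R R (dualCoact k R f) = leftContract f := by
  simp [evalDual, dualCoact]

theorem dualCoact_injective : Function.Injective (dualCoact k R) := by
  intro f g h
  have h1 : leftContract f = leftContract g := by
    rw [← evalDual_dualCoact, h, evalDual_dualCoact]
  -- The counit recovers f from its contraction operator.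
  have h2 (f : Module.Dual k R) : counit (R := k) ∘ₗ leftContract f = f := by
    have h3 : counit (R := k) ∘ₗ (TensorProduct.lid k R).toLinearMap ∘ₗ f.rTensor R =
        f ∘ₗ (TensorProduct.rid k R).toLinearMap ∘ₗ (counit (R := k)).lTensor R := by
      ext; simp [mul_comm]
    ext x
    simpa [leftContract] using congr($h3 (comul (R := k) x))
  rw [← h2 f, h1, h2]

theorem dualCoact_coassoc :
    TensorProduct.assoc k R R (Module.Dual k R) ∘ₗ
      (comul (R := k)).rTensor (Module.Dual k R) ∘ₗ dualCoact k R =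
      (dualCoact k R).lTensor R ∘ₗ dualCoact k R := by
  ext1 f
  apply (TensorProduct.assoc k R R (Module.Dual k R)).symm.injective
  apply evalDual_injective
  ext1 x
  have h1 : (evalDual k R (R ⊗[k] R)).flip x ∘ₗ (comul (R := k)).rTensor (Module.Dual k R) =
      comul (R := k) ∘ₗ (evalDual k R R).flip x := by
    ext; simp
  have h2 : (evalDual k R (R ⊗[k] R)).flip x ∘ₗ
      (TensorProduct.assoc k R R (Module.Dual k R)).symm.toLinearMap =
      ((evalDual k R R).flip x).lTensor R := by
    ext; simp
  have h3 : ((evalDual k R R).flip x).lTensor R ∘ₗ (dualCoact k R).lTensor R =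
      LinearMap.applyₗ (comul (R := k) x) ∘ₗ LinearMap.rTensorHom R ∘ₗ evalDual k R R := by
    ext a f
    simp only [TensorProduct.AlgebraTensorModule.curry_apply, TensorProduct.curry_apply,
      LinearMap.coe_restrictScalars, LinearMap.comp_apply, LinearMap.lTensor_tmul,
      LinearMap.flip_apply, evalDual_dualCoact, leftContract, LinearMap.applyₗ_apply_apply,
      LinearMap.coe_rTensorHom]
    generalize comul (R := k) x = w
    induction w with
    | zero => simp
    | add u v hu hv => simp only [map_add, TensorProduct.tmul_add, hu, hv]
    | tmul c d => simp [TensorProduct.smul_tmul]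
  have h4 : (leftContract f).rTensor R (comul (R := k) x) = comul (R := k) (leftContract f x) := by
    set Θ : R ⊗[k] (R ⊗[k] R) →ₗ[k] R ⊗[k] R :=
      (TensorProduct.lid k (R ⊗[k] R)).toLinearMap ∘ₗ f.rTensor (R ⊗[k] R) with hΘ
    have h5 : comul (R := k) ∘ₗ (TensorProduct.lid k R).toLinearMap ∘ₗ f.rTensor R =
        Θ ∘ₗ (comul (R := k)).lTensor R := by
      ext; simp [Θ]
    have h6 : ((TensorProduct.lid k R).toLinearMap ∘ₗ f.rTensor R).rTensor R =
        Θ ∘ₗ (TensorProduct.assoc k R R R).toLinearMap := by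
      ext; simp [Θ, TensorProduct.smul_tmul']
    have e5 := congr($h5 (comul (R := k) x))
    have e6 := congr($h6 ((comul (R := k)).rTensor R (comul (R := k) x)))
    have e7 := congr(Θ ($(assoc_comp_rTensor_comp_comul R) x))
    simp only [LinearMap.comp_apply] at e5 e6 e7
    rw [leftContract, ← LinearMap.comp_assoc, LinearMap.rTensor_comp, LinearMap.comp_apply, e6]
    exact e7.trans e5.symm
  have e1 := congr($h1 (dualCoact k R f))
  have e2 := congr($h2 ((dualCoact k R).lTensor R (dualCoact k R f)))
  have e3 := congr($h3 (dualCoact k R f))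
  simp only [LinearMap.comp_apply, LinearMap.flip_apply, LinearEquiv.coe_coe,
    evalDual_dualCoact] at e1 e2 e3 ⊢
  rw [e2, e3, LinearEquiv.symm_apply_apply, e1]
  exact h4.symm

namespace IsHopfAlgebra

/-- Evaluated at x, both sides become y₍₁₎ (y₍₂₎₍₋₁₎ g(`dualAct` y₍₂₎₍₀₎ x)) with g = `leftContract
f`. -/
theorem dualCoact_dualAlgHom (hV : V.IsHopfAlgebra) (hS : V.IsAntipode S) (y : R)
    (f : Module.Dual k R) :
    dualCoact k R (hV.dualAlgHom hS y f) =
      hV.comulAct (hV.dualAlgHom hS) y (dualCoact k R f) := by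
  apply evalDual_injective
  ext1 x
  rw [evalDual_dualCoact]
  set F : R ⊗[k] R →ₗ[k] R := (TensorProduct.lid k R).toLinearMap ∘ₗ f.rTensor R with hF
  set u := dualCoact k R f with hu
  have h1 : leftContract (hV.dualAlgHom hS y f) x =
      F ((V.dualAct S y).rTensor R (comul (R := k) x)) := by
    have : f ∘ₗ V.dualAct S y = hV.dualAlgHom hS y f := rfl
    simp [leftContract, F, ← this, LinearMap.rTensor_comp]
  have h2 := fun z => conv_congr V.coact (onRight R V.act).toLinearMap
    (comul (R := k) ∘ₗ (V.dualAct S).flip x) V.act.toLinearMap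
    (leftContract f ∘ₗ (V.dualAct S).flip x) F .id (fun h z => by
      have : F ∘ₗ onRight R V.act h = V.act h ∘ₗ F := by ext; simp [F]
      exact congr($this _)) z
  have h3 := conv_congr comul (onRight R (Algebra.lmul k R)).toLinearMap
    (conv V.coact (onRight R V.act).toLinearMap (comul (R := k) ∘ₗ (V.dualAct S).flip x))
    (Algebra.lmul k R).toLinearMap
    (conv V.coact V.act.toLinearMap (leftContract f ∘ₗ (V.dualAct S).flip x)) F .id
    (fun a z => by
      have : F ∘ₗ onRight R (Algebra.lmul k R) a = Algebra.lmul k R a ∘ₗ F := by ext; simp [F]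
      refine (congr($this _)).trans ?_
      rw [LinearMap.comp_apply, h2]
      rfl) y
  rw [h1, hV.rTensor_dualAct_comul hS, h3]
  have h4 := fun z => conv_congr V.coact (V.actLeft (Module.Dual k R)).toLinearMap
    (onRight R (hV.dualAlgHom hS)).toLinearMap V.act.toLinearMap
    (leftContract f ∘ₗ (V.dualAct S).flip x)
    ((evalDual k R R).flip x ∘ₗ LinearMap.applyₗ u) .id (fun h z => by
      have h5 : (evalDual k R R).flip x ∘ₗ V.actLeft (Module.Dual k R) h =
          V.act h ∘ₗ (evalDual k R R).flip x := by ext; simp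
      have h6 : (evalDual k R R).flip x ∘ₗ onRight R (hV.dualAlgHom hS) z =
          (evalDual k R R).flip (V.dualAct S z x) := by ext; simp [dualAlgHom_apply]
      refine (congr($h5 (onRight R (hV.dualAlgHom hS) z u))).trans ?_
      rw [LinearMap.comp_apply]
      refine (congr(V.act h ($h6 u))).trans ?_
      simp [u]) z
  have h5 := conv_congr comul (mulLeft k R (Module.Dual k R)).toLinearMap
    (hV.braidedAct (hV.dualAlgHom hS)).toLinearMap
    (Algebra.lmul k R).toLinearMap
    (conv V.coact V.act.toLinearMap (leftContract f ∘ₗ (V.dualAct S).flip x))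
    ((evalDual k R R).flip x ∘ₗ LinearMap.applyₗ u) .id (fun a z => by
      have h6 : (evalDual k R R).flip x ∘ₗ mulLeft k R (Module.Dual k R) a =
          Algebra.lmul k R a ∘ₗ (evalDual k R R).flip x := by ext; simp
      refine (congr($h6 _)).trans ?_
      rw [LinearMap.comp_apply, hV.braidedAct_eq_conv]
      exact congr(a * $(h4 z))) y
  exact h5.symm

/-- A finite-dimensional Hopf algebra has a nonzero integral on it. -/
theorem exists_integral (hV : V.IsHopfAlgebra) (hS : V.IsAntipode S) [Nontrivial R] :
    ∃ f : Module.Dual k R, f ≠ 0 ∧ ∀ x, leftContract f x = f x • 1 := by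
  obtain ⟨f, hf, h⟩ := hV.exists_coinvariant_ne_zero hS (hV.dualCoact_dualAlgHom hS)
    dualCoact_coassoc dualCoact_injective
  refine ⟨f, hf, fun x => ?_⟩
  rw [← evalDual_dualCoact, h, evalDual_tmul]

theorem eq_zero_of_integral_dualAct (hV : V.IsHopfAlgebra) (hS : V.IsAntipode S)
    {f : Module.Dual k R} (hf0 : f ≠ 0) (hf : ∀ x, leftContract f x = f x • 1) {y : R}
    (hy : ∀ x, f (V.dualAct S y x) = 0) : y = 0 := by
  refine hV.eq_zero_of_apply_coinvariant hS (hV.dualCoact_dualAlgHom hS) (m := f) ?_ hf0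
    (LinearMap.ext hy)
  apply evalDual_injective
  ext x
  simp [hf]

end IsHopfAlgebra

end DualCoaction
end
end ActionCoaction

/-! ### Gradings and homogeneous integrals -/

namespace ActionCoaction

noncomputable section

open Coalgebra Module.End

section Glue

variable {k R X : Type*} [Field k] [AddCommGroup R] [Module k R] [AddCommGroup X] [Module k X]
  {𝒜 : ℕ → Submodule k R}

/-- The linear map which is `f n` on the `n`-th summand of an internal direct sum. -/
def glue (h : DirectSum.IsInternal 𝒜) (f : ℕ → R →ₗ[k] X) : R →ₗ[k] X :=
  DirectSum.toModule k ℕ X (fun n => f n ∘ₗ (𝒜 n).subtype) ∘ₗ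
    (LinearEquiv.ofBijective (DirectSum.coeLinearMap 𝒜) h).symm.toLinearMap

theorem glue_apply (h : DirectSum.IsInternal 𝒜) (f : ℕ → R →ₗ[k] X) {n : ℕ} {x : R}
    (hx : x ∈ 𝒜 n) : glue h f x = f n x := by
  have : (LinearEquiv.ofBijective (DirectSum.coeLinearMap 𝒜) h).symm x =
      DirectSum.lof k ℕ (fun n => 𝒜 n) n ⟨x, hx⟩ := by
    rw [LinearEquiv.symm_apply_eq]
    exact (DirectSum.coeLinearMap_lof 𝒜 n ⟨x, hx⟩).symm
  simp [glue, this]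

theorem linearMap_ext_of_isInternal (h : DirectSum.IsInternal 𝒜) {f g : R →ₗ[k] X}
    (hfg : ∀ n, ∀ x ∈ 𝒜 n, f x = g x) : f = g := by
  ext x
  have hx : x ∈ ⨆ n, 𝒜 n := by rw [h.submodule_iSup_eq_top]; trivial
  induction hx using Submodule.iSup_induction' with
  | mem n x hx => exact hfg n x hx
  | zero => simp
  | add x y _ _ hx hy => simp [hx, hy]

/-- The projection onto a summand of an internal direct sum. -/
def projOn (h : DirectSum.IsInternal 𝒜) (n : ℕ) : R →ₗ[k] R :=
  glue h fun m => if m = n then .id else 0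

theorem projOn_of_mem (h : DirectSum.IsInternal 𝒜) {n : ℕ} {x : R} (hx : x ∈ 𝒜 n) :
    projOn h n x = x := by
  simp [projOn, glue_apply h _ hx]

theorem projOn_of_mem_of_ne (h : DirectSum.IsInternal 𝒜) {m n : ℕ} {x : R} (hx : x ∈ 𝒜 m)
    (hmn : m ≠ n) : projOn h n x = 0 := by
  simp [projOn, glue_apply h _ hx, hmn]

theorem projOn_mem (h : DirectSum.IsInternal 𝒜) (n : ℕ) (x : R) : projOn h n x ∈ 𝒜 n := by
  have : (𝒜 n).mkQ ∘ₗ projOn h n = 0 := by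
    refine linearMap_ext_of_isInternal h fun m x hx => ?_
    obtain rfl | hmn := eq_or_ne m n
    · simpa [projOn_of_mem h hx] using hx
    · simp [projOn_of_mem_of_ne h hx hmn]
  simpa using congr($this x)

end Glue

namespace IsGradedHopfAlgebra

variable {k H R : Type*} [Field k] [Ring H] [HopfAlgebra k H] [Ring R] [Algebra k R]
  [Coalgebra k R] {V : ActionCoaction k H R} {𝒜 : ℕ → Submodule k R} {S : R →ₗ[k] R}

theorem projOn_mul (hR : V.IsGradedHopfAlgebra 𝒜) (m : ℕ) {n : ℕ} (y : R) {x : R}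
    (hx : x ∈ 𝒜 n) :
    projOn hR.isInternal (m + n) (y * x) = projOn hR.isInternal m y * x := by
  have : projOn hR.isInternal (m + n) ∘ₗ LinearMap.mulRight k x =
      LinearMap.mulRight k x ∘ₗ projOn hR.isInternal m := by
    refine linearMap_ext_of_isInternal hR.isInternal fun i y hy => ?_
    obtain rfl | him := eq_or_ne i m
    · simp [projOn_of_mem _ hy, projOn_of_mem _ (hR.mul_mem _ _ y hy x hx)]
    · have : i + n ≠ m + n := by omega
      simp [projOn_of_mem_of_ne _ hy him,
        projOn_of_mem_of_ne _ (hR.mul_mem _ _ y hy x hx) this]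
  exact congr($this y)

theorem one_mem (hR : V.IsGradedHopfAlgebra 𝒜) : (1 : R) ∈ 𝒜 0 := by
  -- The degree-0 part of 1 is already a left identity, hence equals 1.
  have h : LinearMap.mulLeft k (projOn hR.isInternal 0 1) = .id := by
    refine linearMap_ext_of_isInternal hR.isInternal fun n x hx => ?_
    have := hR.projOn_mul 0 1 hx
    rw [zero_add, one_mul, projOn_of_mem _ hx] at this
    exact this.symm
  have h1 : projOn hR.isInternal 0 1 = 1 := by simpa using congr($h 1)
  rw [← h1]
  exact projOn_mem _ _ _

theorem comul_ext (hR : V.IsGradedHopfAlgebra 𝒜) {X : Type*} [AddCommGroup X] [Module k X]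
    {f g : R ⊗[k] R →ₗ[k] X} {n : ℕ}
    (hfg : ∀ p q, p + q = n → ∀ a ∈ 𝒜 p, ∀ b ∈ 𝒜 q, f (a ⊗ₜ b) = g (a ⊗ₜ b)) {x : R}
    (hx : x ∈ 𝒜 n) : f (comul (R := k) x) = g (comul (R := k) x) := by
  have h1 : (⨆ p ∈ Finset.HasAntidiagonal.antidiagonal n,
      LinearMap.range (TensorProduct.mapIncl (𝒜 p.1) (𝒜 p.2))) ≤ LinearMap.eqLocus f g := by
    refine iSup₂_le fun p hp => ?_
    rintro _ ⟨u, rfl⟩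
    have h2 : f ∘ₗ TensorProduct.mapIncl (𝒜 p.1) (𝒜 p.2) =
        g ∘ₗ TensorProduct.mapIncl (𝒜 p.1) (𝒜 p.2) := by
      ext a b
      exact hfg _ _ (Finset.HasAntidiagonal.mem_antidiagonal.1 hp) a a.2 b b.2
    exact congr($h2 u)
  exact h1 (hR.comul_mem n x hx)

/-- The degree-0 part of the counit is still a left counit, and a left counit agrees with a right
one. -/
theorem counit_comp_projOn (hR : V.IsGradedHopfAlgebra 𝒜) :
    counit (R := k) ∘ₗ projOn hR.isInternal 0 = counit (R := k) (A := R) := by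
  set P := projOn hR.isInternal with hP
  have h1 (x : R) :
      TensorProduct.lid k R ((counit (R := k) ∘ₗ P 0).rTensor R (comul (R := k) x)) = x := by
    have : (TensorProduct.lid k R).toLinearMap ∘ₗ (counit (R := k) ∘ₗ P 0).rTensor R ∘ₗ
        comul (R := k) = .id := by
      refine linearMap_ext_of_isInternal hR.isInternal fun n x hx => ?_
      have h2 := hR.comul_ext
        (f := (TensorProduct.lid k R).toLinearMap ∘ₗ (counit (R := k) ∘ₗ P 0).rTensor R)
        (g := P n ∘ₗ (TensorProduct.lid k R).toLinearMap ∘ₗ (counit (R := k)).rTensor R)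
        (fun p q hpq a ha b hb => by
          obtain rfl | hp := eq_or_ne p 0
          · rw [zero_add] at hpq
            subst hpq
            simp [P, projOn_of_mem _ ha, projOn_of_mem _ hb]
          · have : q ≠ n := by omega
            simp [P, projOn_of_mem_of_ne _ ha hp, projOn_of_mem_of_ne _ hb this]) hx
      refine h2.trans ?_
      simp [P, projOn_of_mem _ hx]
    exact congr($this x)
  ext x
  have h2 : (counit (R := k) ∘ₗ P 0) ∘ₗ (TensorProduct.rid k R).toLinearMap ∘ₗ
      (counit (R := k)).lTensor R = counit (R := k) ∘ₗ (TensorProduct.lid k R).toLinearMap ∘ₗ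
        (counit (R := k) ∘ₗ P 0).rTensor R := by
    ext; simp [mul_comm]
  have h3 := congr($h2 (comul (R := k) x))
  simp only [LinearMap.comp_apply, LinearEquiv.coe_coe, h1] at h3
  rw [← h3]
  simp

theorem counit_eq_zero (hR : V.IsGradedHopfAlgebra 𝒜) {n : ℕ} (hn : n ≠ 0) {x : R}
    (hx : x ∈ 𝒜 n) : counit (R := k) x = 0 := by
  rw [← hR.counit_comp_projOn, LinearMap.comp_apply, projOn_of_mem_of_ne _ hx hn, map_zero]

theorem antipode_mem (hR : V.IsGradedHopfAlgebra 𝒜) (hS : V.IsAntipode S) {n : ℕ} {x : R}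
    (hx : x ∈ 𝒜 n) : S x ∈ 𝒜 n := by
  set P := projOn hR.isInternal with hP
  -- `T` is the degree-preserving part of `S`. It is again a left convolution inverse of the
  -- identity, so it equals `S`.
  set T := glue hR.isInternal fun n => P n ∘ₗ S with hT
  have h1 : conv comul T (.id : R →ₗ[k] R) = (counit (R := k)).smulRight (1 : R) := by
    refine linearMap_ext_of_isInternal hR.isInternal fun n x hx => ?_
    have h2 := hR.comul_ext
      (f := TensorProduct.lift ((Algebra.lsmul k k R).toLinearMap.compl₁₂ T .id))
      (g := P n ∘ₗ LinearMap.mul' k R ∘ₗ S.rTensor R)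
      (fun p q hpq a ha b hb => by
        subst hpq
        simp [T, glue_apply _ _ ha, P, hR.projOn_mul p _ hb]) hx
    have h3 := congr(P n ($hS.rTensor x))
    refine h2.trans (h3.trans ?_)
    obtain rfl | hn := eq_or_ne n 0
    · simp [Algebra.algebraMap_eq_smul_one, P, projOn_of_mem _ hR.one_mem]
    · simp [hR.counit_eq_zero hn hx]
  have h2 : T = S := by
    have h3 := conv_assoc (assoc_comp_rTensor_comp_comul R) T (.id : R →ₗ[k] R) S
    have h4 := conv_antipode_right hS.lTensor (AlgHom.id k R)
    simp only [AlgHom.toLinearMap_id, LinearMap.id_comp] at h4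
    rw [h1, h4, conv_counit_left rTensor_counit_comp_comul] at h3
    rw [h3]
    ext1 y
    rw [conv_counit_right, smul_eq_mul, mul_one]
  rw [← h2, hT, glue_apply _ _ hx]
  exact projOn_mem _ _ _

theorem dualAct_mem (hR : V.IsGradedHopfAlgebra 𝒜) (hS : V.IsAntipode S) {i j : ℕ} {x y : R}
    (hy : y ∈ 𝒜 i) (hx : x ∈ 𝒜 j) : V.dualAct S y x ∈ 𝒜 (i + j) := by
  obtain ⟨u, hu⟩ := hR.coact_mem i y hy
  rw [dualAct, conv, LinearMap.comp_apply, ← hu]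
  clear hu
  induction u with
  | zero => simp
  | add u v hu hv => simpa only [map_add, LinearMap.add_apply] using add_mem hu hv
  | tmul h r =>
    simpa [antipodeAct] using
      hR.act_mem _ _ _ (hR.mul_mem _ _ _ (hR.antipode_mem hS r.2) _ hx)

theorem leftContract_comp_projOn (hR : V.IsGradedHopfAlgebra 𝒜) {f : Module.Dual k R}
    (hf : ∀ x, leftContract f x = f x • 1) (d : ℕ) (x : R) :
    leftContract (f ∘ₗ projOn hR.isInternal d) x = (f ∘ₗ projOn hR.isInternal d) x • 1 := by
  set P := projOn hR.isInternal with hP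
  have h : leftContract (f ∘ₗ P d) = (f ∘ₗ P d).smulRight 1 := by
    refine linearMap_ext_of_isInternal hR.isInternal fun n x hx => ?_
    obtain hn | ⟨m, rfl⟩ := (lt_or_ge n d).imp_right Nat.exists_eq_add_of_le
    · have h1 := hR.comul_ext
        (f := (TensorProduct.lid k R).toLinearMap ∘ₗ (f ∘ₗ P d).rTensor R) (g := 0)
        (fun p q hpq a ha b hb => by
          have : p ≠ d := by omega
          simp [P, projOn_of_mem_of_ne _ ha this]) hx
      refine h1.trans ?_
      simp [P, projOn_of_mem_of_ne _ hx hn.ne]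
    -- In degree d + m, contracting with the degree-d part of f is the degree-m part of contracting
    -- with f, namely of f(x) 1; this vanishes unless m = 0.
    · have h1 := hR.comul_ext
        (f := (TensorProduct.lid k R).toLinearMap ∘ₗ (f ∘ₗ P d).rTensor R)
        (g := P m ∘ₗ (TensorProduct.lid k R).toLinearMap ∘ₗ f.rTensor R)
        (fun p q hpq a ha b hb => by
          obtain rfl | hp := eq_or_ne p d
          · obtain rfl : q = m := by omega
            simp [P, projOn_of_mem _ ha, projOn_of_mem _ hb]
          · have : q ≠ m := by omega
            simp [P, projOn_of_mem_of_ne _ ha hp, projOn_of_mem_of_ne _ hb this]) hx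
      refine h1.trans (congr(P m $(hf x)).trans ?_)
      obtain rfl | hm := eq_or_ne m 0
      · rw [add_zero] at hx
        simp [P, projOn_of_mem _ hx, projOn_of_mem _ hR.one_mem]
      · have : d + m ≠ d := by omega
        simp [P, projOn_of_mem_of_ne _ hx this, projOn_of_mem_of_ne _ hR.one_mem hm.symm]
  exact congr($h x)

variable [FiniteDimensional k R]

/-- A nonzero graded Hopf algebra has a homogeneous nonzero integral. -/
theorem exists_homogeneous_integral [Nontrivial R] (hR : V.IsGradedHopfAlgebra 𝒜)
    (hS : V.IsAntipode S) :
    ∃ (d : ℕ) (f : Module.Dual k R), f ≠ 0 ∧ (∀ x, leftContract f x = f x • 1) ∧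
      ∀ n, n ≠ d → ∀ x ∈ 𝒜 n, f x = 0 := by
  obtain ⟨f, hf0, hf⟩ := hR.isHopfAlgebra.exists_integral hS
  obtain ⟨d, hd⟩ : ∃ d, f ∘ₗ projOn hR.isInternal d ≠ 0 := by
    by_contra! h
    refine hf0 (linearMap_ext_of_isInternal hR.isInternal fun n x hx => ?_)
    simpa [projOn_of_mem _ hx] using congr($(h n) x)
  refine ⟨d, _, hd, hR.leftContract_comp_projOn hf d, fun n hn x hx => ?_⟩
  simp [projOn_of_mem_of_ne _ hx hn]

theorem eq_zero_of_homogeneous_integral (hR : V.IsGradedHopfAlgebra 𝒜) (hS : V.IsAntipode S)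
    {d : ℕ} {f : Module.Dual k R} (hf0 : f ≠ 0) (hf : ∀ x, leftContract f x = f x • 1)
    (hfd : ∀ n, n ≠ d → ∀ x ∈ 𝒜 n, f x = 0) {i : ℕ} {y : R} (hy : y ∈ 𝒜 i)
    (h : ∀ j, i + j = d → ∀ x ∈ 𝒜 j, f (V.dualAct S y x) = 0) : y = 0 := by
  refine hR.isHopfAlgebra.eq_zero_of_integral_dualAct hS hf0 hf fun x => ?_
  have : f ∘ₗ V.dualAct S y = 0 := by
    refine linearMap_ext_of_isInternal hR.isInternal fun j x hx => ?_
    by_cases hij : i + j = d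
    · exact h j hij x hx
    · exact hfd _ hij _ (hR.dualAct_mem hS hy hx)
  exact congr($this x)

/-- The map y ↦ f(`dualAct` y ·) embeds R(i) in the dual of R(j): by degree, no other component of x
can contribute. -/
theorem finrank_le (hR : V.IsGradedHopfAlgebra 𝒜) (hS : V.IsAntipode S)
    {f : Module.Dual k R} (hf0 : f ≠ 0) (hf : ∀ x, leftContract f x = f x • 1) {i j : ℕ}
    (hfd : ∀ n, n ≠ i + j → ∀ x ∈ 𝒜 n, f x = 0) :
    Module.finrank k (𝒜 i) ≤ Module.finrank k (𝒜 j) := by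
  rw [← Subspace.dual_finrank_eq (V := 𝒜 j)]
  refine LinearMap.finrank_le_finrank_of_injective
    (f := Module.Dual.transpose (R := k) (𝒜 j).subtype ∘ₗ LinearMap.llcomp k R R k f ∘ₗ
      V.dualAct S ∘ₗ (𝒜 i).subtype) ?_
  rw [injective_iff_map_eq_zero]
  intro y hy
  refine Subtype.ext (hR.eq_zero_of_homogeneous_integral hS hf0 hf hfd y.2 fun l hl x hx => ?_)
  obtain rfl : l = j := by omega
  exact congr($hy ⟨x, hx⟩)

end IsGradedHopfAlgebra

end

end ActionCoaction

theorem mainTheorem4 {k H R : Type*} [Field k] [Ring H] [HopfAlgebra k H]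
    (hS : Function.Bijective (HopfAlgebra.antipode k : H →ₗ[k] H))
    [Ring R] [Algebra k R] [Coalgebra k R] [FiniteDimensional k R]
    (V : ActionCoaction k H R) (𝒜 : ℕ → Submodule k R) (hR : V.IsGradedHopfAlgebra 𝒜)
    (N : ℕ) (hN : 𝒜 N ≠ ⊥) (hgt : ∀ i, N < i → 𝒜 i = ⊥) :
    ∀ i ≤ N, Module.finrank k (𝒜 i) = Module.finrank k (𝒜 (N - i)) := by
  obtain ⟨S, hS1, hS2, hS3⟩ := hR.isHopfAlgebra.exists_antipode
  have hanti : V.IsAntipode S := ⟨hS1, hS2, hS3⟩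
  obtain ⟨z, hz, hz0⟩ := (Submodule.ne_bot_iff _).1 hN
  have : Nontrivial R := ⟨z, 0, hz0⟩
  obtain ⟨d, f, hf0, hf, hfd⟩ := hR.exists_homogeneous_integral hanti
  have hd : d = N := by
    apply le_antisymm
    · by_contra! h
      refine hf0 (ActionCoaction.linearMap_ext_of_isInternal hR.isInternal fun n x hx => ?_)
      by_cases hn : n = d
      · subst hn
        rw [hgt n h, Submodule.mem_bot] at hx
        simp [hx]
      · exact hfd n hn x hx
    -- If d < N, no degree j satisfies N + j = d, so z pairs to zero with everything and must
    -- vanish.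
    · by_contra! h
      exact hz0 (hR.eq_zero_of_homogeneous_integral hanti hf0 hf hfd hz
        fun j hj => absurd hj (by omega))
  subst hd
  intro i hi
  apply le_antisymm
  · exact hR.finrank_le hanti hf0 hf (by rwa [Nat.add_sub_cancel' hi])
  · exact hR.finrank_le hanti hf0 hf (by rwa [Nat.sub_add_cancel hi])
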